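/- Fix $c>0$ and $\lambda>0$. For $\nu\ge 0$ let $$X_\nu(t)=c\sum_{j=1}^{N(t)+1}(s_j-s_{j-1})\cos\theta_j,$$ where $N$ is a homogeneous Poisson process of rate $\lambda$ with event times $0<s_1<s_2<\cdots$, with the conventions $s_0=0$ and $s_{N(t)+1}=t$, and where $\theta_1,\theta_2,\dots$ are independent random variables, independent of $N$, with density $\frac{\Gamma(\nu+1)}{\sqrt{\pi}\,\Gamma(\nu+\frac12)}\sin^{2\nu}\theta$ on $(0,\pi)$. Let $t>0$. (i) For every real $\nu\ge0$, the conditional law of $X_\nu(t)$ given $N(t)=0$ is the absolutely continuous law on $(-ct,ct)$ with density $$p_0^\nu(x,t)=\frac{\Gamma(\nu)\Gamma(\nu+1)}{2\pi\,\Gamma(2\nu)}\Big(\frac{2}{ct}\Big)^{2\nu}(c^2t^2-x^2)^{\nu-\frac12},\qquad |x|<ct,$$ where for $\nu=0$ the first factor is replaced by its limit $\frac1\pi$ as $\nu\to0^+$. (ii) For $m\in\{0,1\}$ and every integer $n\ge1$, put $v_0=\frac n2$ and $v_1=n+1$. The conditional law of $X_m(t)$ given $N(t)=n$ is the absolutely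 continuous law on $(-ct,ct)$ with density $$p_n^m(x,t)=\frac{\Gamma(v_m)\Gamma(v_m+1)}{2\pi\,\Gamma(2v_m)}\Big(\frac{2}{ct}\Big)^{2v_m}(c^2t^2-x^2)^{v_m-\frac12},\qquad |x|<ct.$$ (iii) For $d\ge2$ let $Y_d(t)=c\sum_{j=1}^{N(t)+1}(s_j-s_{j-1})V_j$ be the random flight in $\mathbb{R}^d$ with speed $c$ and rate $\lambda$, where the $V_j$ are independent, uniformly distributed on the unit sphere of $\mathbb{R}^d$, and independent of $N$. Then $X_0$ has the same law as the first coordinate of the planar random flight $Y_2$, and $X_1$ has the same law as the first coordinate of the four-dimensional random flight $Y_4$: the processes indexed by $t\ge0$ have the same law, and for every $t>0$ and $n\ge0$ the conditional laws given $N(t)=n$ agree. -/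

import Mathlib

open MeasureTheory ProbabilityTheory Filter Topology
open scoped NNReal ENNReal

noncomputable section

/-- The times of the Poisson events, `s 0 = 0` and `s j = T 0 + ... + T (j - 1)`, where `T j` is
the waiting time between the `j`-th and the `(j + 1)`-st event. -/
def arrivalTime {Ω : Type*} (T : ℕ → Ω → ℝ) (j : ℕ) (ω : Ω) : ℝ :=
  ∑ i ∈ Finset.range j, T i ω

/-- The counting process `N(t)`: the number of indices `j ≥ 1` with `s j ≤ t`. -/
def eventCount {Ω : Type*} (T : ℕ → Ω → ℝ) (t : ℝ) (ω : Ω) : ℕ :=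
  Set.ncard {j : ℕ | arrivalTime T (j + 1) ω ≤ t}

/-- The epochs used at time `t`: `s 0 = 0, s 1, ..., s N(t)` followed by `t`
(the convention `s (N(t) + 1) = t`). -/
def epoch {Ω : Type*} (T : ℕ → Ω → ℝ) (t : ℝ) (j : ℕ) (ω : Ω) : ℝ :=
  if j ≤ eventCount T t ω then arrivalTime T j ω else t

/-- The position at time `t` of a particle which starts at the origin, has velocity `c • u 0`
up to the first event, and takes the new velocity `c • u j` at the `j`-th event:
`c ∑_{j = 1}^{N(t) + 1} (s j - s (j - 1)) u (j - 1)`. -/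
def randomMotion {Ω E : Type*} [AddCommGroup E] [Module ℝ E] (c : ℝ) (T : ℕ → Ω → ℝ)
    (u : ℕ → Ω → E) (t : ℝ) (ω : Ω) : E :=
  c • ∑ j ∈ Finset.range (eventCount T t ω + 1),
    (epoch T t (j + 1) ω - epoch T t j ω) • u j ω

/-- The waiting times of a homogeneous Poisson process of rate `rate`: independent and
exponentially distributed. -/
structure IsPoissonClock {Ω : Type*} [MeasurableSpace Ω] (P : Measure Ω) (rate : ℝ)
    (T : ℕ → Ω → ℝ) : Prop where
  measurable : ∀ j, Measurable (T j)
  indep : iIndepFun T P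
  law : ∀ j, P.map (T j) = expMeasure rate

/-- `T` are the waiting times of a Poisson process, and `Y` is a sequence of independent random
variables with common law `μ`, independent of that process. -/
structure IsMarkedPoissonClock {Ω S : Type*} [MeasurableSpace Ω] [MeasurableSpace S]
    (P : Measure Ω) (rate : ℝ) (μ : Measure S) (T : ℕ → Ω → ℝ) (Y : ℕ → Ω → S) : Prop where
  clock : IsPoissonClock P rate T
  measurable : ∀ j, Measurable (Y j)
  indep : iIndepFun Y P
  law : ∀ j, P.map (Y j) = μ
  indep_clock : IndepFun (fun ω j => T j ω) (fun ω j => Y j ω) P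

/-- The law on `(0, π)` with density `Γ(ν + 1) / (√π Γ(ν + 1/2)) * sin(θ)^(2ν)`. -/
def angleLaw (ν : ℝ) : Measure ℝ :=
  (volume.restrict (Set.Ioo 0 Real.pi)).withDensity fun θ =>
    ENNReal.ofReal (Real.Gamma (ν + 1) / (√Real.pi * Real.Gamma (ν + 1 / 2)) *
      Real.sin θ ^ (2 * ν))

/-- The process `X(t) = c ∑_{j = 1}^{N(t) + 1} (s j - s (j - 1)) cos(θ j)`. -/
def cosMotion {Ω : Type*} (c : ℝ) (T θ : ℕ → Ω → ℝ) (t : ℝ) (ω : Ω) : ℝ :=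
  randomMotion c T (fun j ω => Real.cos (θ j ω)) t ω

/-- The uniform probability on the unit sphere of `ℝ^d`: normalized surface measure. -/
def uniformDirection (d : ℕ) : Measure (Metric.sphere (0 : EuclideanSpace ℝ (Fin d)) 1) :=
  ((volume : Measure (EuclideanSpace ℝ (Fin d))).toSphere Set.univ)⁻¹ •
    (volume : Measure (EuclideanSpace ℝ (Fin d))).toSphere

/-- The random flight in `ℝ^d` with speed `c` and directions `V 0, V 1, ...`. -/
def randomFlight {Ω : Type*} {d : ℕ} (c : ℝ) (T : ℕ → Ω → ℝ)
    (V : ℕ → Ω → Metric.sphere (0 : EuclideanSpace ℝ (Fin d)) 1) (t : ℝ) (ω : Ω) :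
    EuclideanSpace ℝ (Fin d) :=
  randomMotion c T (fun j ω => (V j ω : EuclideanSpace ℝ (Fin d))) t ω

/-- The conditional law of the random variable `Z` given the event `N(t) = n`. -/
def lawGivenCount {Ω : Type*} [MeasurableSpace Ω] (P : Measure Ω) (T : ℕ → Ω → ℝ) (t : ℝ)
    (n : ℕ) (Z : Ω → ℝ) : Measure ℝ :=
  (ProbabilityTheory.cond P {ω | eventCount T t ω = n}).map Z

/-- The constant `Γ(v) Γ(v + 1) / (2π Γ(2v))`, extended to `v = 0` by its limit `1 / π`. -/
def densityConst (v : ℝ) : ℝ :=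
  if v = 0 then 1 / Real.pi
  else Real.Gamma v * Real.Gamma (v + 1) / (2 * Real.pi * Real.Gamma (2 * v))

/-- The value of `densityConst` at `0` is the limit of `Γ(v) Γ(v + 1) / (2π Γ(2v))`. -/
theorem tendsto_densityConst :
    Tendsto (fun v : ℝ => Real.Gamma v * Real.Gamma (v + 1) / (2 * Real.pi * Real.Gamma (2 * v)))
      (𝓝[>] 0) (𝓝 (densityConst 0)) := by
  have hg : ContinuousAt Real.Gamma 1 := by
    refine (Real.differentiableAt_Gamma fun m => ?_).continuousAt
    have : (0 : ℝ) ≤ m := m.cast_nonneg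
    linarith
  have h1 : Tendsto (fun v : ℝ => Real.Gamma (v + 1)) (𝓝[>] 0) (𝓝 1) := by
    have h : Tendsto (fun v : ℝ => v + 1) (𝓝[>] 0) (𝓝 1) := by
      have : ContinuousAt (fun v : ℝ => v + 1) 0 := by fun_prop
      simpa using this.tendsto.mono_left nhdsWithin_le_nhds
    simpa [Function.comp_def] using hg.tendsto.comp h
  have h2 : Tendsto (fun v : ℝ => Real.Gamma (2 * v + 1)) (𝓝[>] 0) (𝓝 1) := by
    have h : Tendsto (fun v : ℝ => 2 * v + 1) (𝓝[>] 0) (𝓝 1) := by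
      have : ContinuousAt (fun v : ℝ => 2 * v + 1) 0 := by fun_prop
      simpa using this.tendsto.mono_left nhdsWithin_le_nhds
    simpa [Function.comp_def] using hg.tendsto.comp h
  have h3 := ((h1.mul h1).div h2 one_ne_zero).div_const Real.pi
  have h4 : densityConst 0 = 1 * 1 / 1 / Real.pi := by simp [densityConst]
  rw [h4]
  refine h3.congr' ?_
  filter_upwards [self_mem_nhdsWithin] with v hv
  have hv : 0 < v := hv
  simp only [Pi.div_apply]
  rw [Real.Gamma_add_one hv.ne', Real.Gamma_add_one (by positivity : (2 * v : ℝ) ≠ 0)]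
  have a := Real.Gamma_pos_of_pos hv
  have b := Real.Gamma_pos_of_pos (by positivity : 0 < 2 * v)
  field_simp

/-- The measure on `(-r, r)` with density
`Γ(v) Γ(v + 1) / (2π Γ(2v)) * (2 / r)^(2v) * (r^2 - x^2)^(v - 1/2)`. -/
def conditionalDensityLaw (v r : ℝ) : Measure ℝ :=
  (volume.restrict (Set.Ioo (-r) r)).withDensity fun x =>
    ENNReal.ofReal (densityConst v * (2 / r) ^ (2 * v) * (r ^ 2 - x ^ 2) ^ (v - 1 / 2))

end

/-! All the laws involved have bounded support, so they are determined by their moments, and the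
conditional law given `n` events is found by computing its moments.

Let `B(z)` be the generating series of the moments of one direction `cos θ`. The clock and the marks
start afresh after the first leg (`measurePreserving_seqConsPair`). Splitting off this leg with the
binomial theorem and evaluating a Beta integral gives, by induction on `n`, that the `k`-th moment
of the unit-speed position at time `t`, restricted to the event of `n` changes of direction, is
`exp(-λt) λ^n t^(n+k) k!/(n+k)! [z^k] B^(n+1)` (`integral_legPow`). Dividing by the case `k = 0`,
the conditional law is that of `ct cos θ` with `θ` of law `angleLaw v` as soon as `[z^k] B^(n+1) =
C(n+k,k) E[cos^k θ]` for every `k`. Such a variable has the stated density, by a change of variables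
and the duplication formula for Gamma (`map_mul_cos_angleLaw`).

For `n = 0` the coefficient identity is trivial with `v = ν`. For `n ≥ 1` both sides satisfy the
same two-step recursion. The moments of `cos θ` obey `(p+2+2v) m_(p+2) = (p+1) m_p`. On the other
side `B = (1-z²)^(-1/2)` when `ν = 0`, and `B = 2(1-√(1-z²))/z²` when `ν = 1`. The powers of these
algebraic functions solve linear differential equations, of order one and two respectively, whose
coefficient recursions force `v = n/2` and `v = n+1`.

For the random flights, a coordinate of a uniform direction in dimension `2ν+2` has the law of `cos
θ` (`map_coord_uniformDirection`): its moments satisfy the same recursion, as one sees by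
integrating against a Gaussian in Cartesian and in polar coordinates. Both processes are then the
same measurable functional of waiting times and marks with the same joint law. -/

noncomputable section

/-! ### Determination of bounded laws by moments. -/

theorem integrable_pow_of_ae_abs_le {μ : Measure ℝ} [IsFiniteMeasure μ] {R : ℝ}
    (hμ : ∀ᵐ x ∂μ, |x| ≤ R) (k : ℕ) : Integrable (fun x => x ^ k) μ := by
  refine Integrable.of_bound (by fun_prop) (R ^ k) ?_
  filter_upwards [hμ] with x hx
  rw [Real.norm_eq_abs, abs_pow]
  exact pow_le_pow_left₀ (abs_nonneg x) hx k

/-- A finite measure with bounded support is determined by its moments. -/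
theorem ext_of_integral_pow {μ ν : Measure ℝ} [IsFiniteMeasure μ] [IsFiniteMeasure ν] {R : ℝ}
    (hμ : ∀ᵐ x ∂μ, |x| ≤ R) (hν : ∀ᵐ x ∂ν, |x| ≤ R)
    (h : ∀ k : ℕ, ∫ x, x ^ k ∂μ = ∫ x, x ^ k ∂ν) : μ = ν := by
  have hp (ρ : Measure ℝ) [IsFiniteMeasure ρ] (hρ : ∀ᵐ x ∂ρ, |x| ≤ R) (p : Polynomial ℝ) :
      Integrable (fun x => p.eval x) ρ ∧
        ∫ x, p.eval x ∂ρ = p.sum fun k a => a * ∫ x, x ^ k ∂ρ := by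
    have hi (k : ℕ) (_ : k ∈ p.support) : Integrable (fun x => p.coeff k * x ^ k) ρ :=
      (integrable_pow_of_ae_abs_le hρ k).const_mul _
    simp only [Polynomial.eval_eq_sum, Polynomial.sum_def]
    refine ⟨integrable_finsetSum _ hi, ?_⟩
    rw [integral_finsetSum _ hi]
    simp only [integral_const_mul]
  refine ext_of_forall_integral_eq_of_IsFiniteMeasure fun f => ?_
  have hb (ε : ℝ) (hε : 0 < ε) :
      |∫ x, f x ∂μ - ∫ x, f x ∂ν| ≤ ε * (μ.real Set.univ + ν.real Set.univ) := by
    -- Weierstrass approximation on `[-R, R]`, which carries both measures. Polynomials integrate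
    -- equally, so only the two approximation errors remain.
    obtain ⟨p, hpf⟩ := exists_polynomial_near_of_continuousOn (-R) R f
      f.continuous.continuousOn ε hε
    have key (ρ : Measure ℝ) [IsFiniteMeasure ρ] (hρ : ∀ᵐ x ∂ρ, |x| ≤ R) :
        |∫ x, f x ∂ρ - ∫ x, p.eval x ∂ρ| ≤ ε * ρ.real Set.univ := by
      rw [← integral_sub (f.integrable ρ) (hp ρ hρ p).1]
      refine norm_integral_le_of_norm_le_const (f := fun x => f x - p.eval x) ?_
      filter_upwards [hρ] with x hx
      rw [Real.norm_eq_abs, abs_sub_comm]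
      exact (hpf x (abs_le.mp hx)).le
    have e : ∫ x, p.eval x ∂μ = ∫ x, p.eval x ∂ν := by
      rw [(hp μ hμ p).2, (hp ν hν p).2]
      simp only [h]
    have h1 := abs_le.mp (key μ hμ)
    have h2 := abs_le.mp (key ν hν)
    rw [e] at h1
    rw [abs_le]
    constructor <;> linarith
  have hlim : Tendsto (fun ε : ℝ => ε * (μ.real Set.univ + ν.real Set.univ)) (𝓝[>] 0) (𝓝 0) := by
    have : ContinuousAt (fun ε : ℝ => ε * (μ.real Set.univ + ν.real Set.univ)) 0 := by fun_prop
    simpa using this.tendsto.mono_left nhdsWithin_le_nhds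
  have := ge_of_tendsto hlim (eventually_nhdsWithin_of_forall hb)
  exact sub_eq_zero.mp (abs_nonpos_iff.mp this)

/-! ### Trigonometric integrals, normalization and density of the angle law. -/

/-- The normalizing constant of `angleLaw`. -/
def angleConst (ν : ℝ) : ℝ := Real.Gamma (ν + 1) / (√Real.pi * Real.Gamma (ν + 1 / 2))

theorem angleConst_pos {ν : ℝ} (hν : 0 ≤ ν) : 0 < angleConst ν := by
  have h1 := Real.Gamma_pos_of_pos (by linarith : 0 < ν + 1)
  have h2 := Real.Gamma_pos_of_pos (by linarith : 0 < ν + 1 / 2)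
  have := Real.pi_pos
  unfold angleConst
  positivity

theorem integral_angleLaw {ν : ℝ} (hν : 0 ≤ ν) (g : ℝ → ℝ) :
    ∫ θ, g θ ∂angleLaw ν =
      angleConst ν * ∫ θ in (0 : ℝ)..Real.pi, g θ * Real.sin θ ^ (2 * ν) := by
  rw [angleLaw, integral_withDensity_eq_integral_toReal_smul (by fun_prop)
    (ae_of_all _ fun _ => ENNReal.ofReal_lt_top),
    intervalIntegral.integral_of_le Real.pi_pos.le, ← integral_Ioc_eq_integral_Ioo,
    ← integral_const_mul, integral_Ioc_eq_integral_Ioo, integral_Ioc_eq_integral_Ioo]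
  refine setIntegral_congr_fun measurableSet_Ioo fun θ hθ => ?_
  have h0 : 0 ≤ Real.sin θ ^ (2 * ν) :=
    Real.rpow_nonneg (Real.sin_pos_of_mem_Ioo hθ).le _
  change (ENNReal.ofReal (angleConst ν * _)).toReal * _ = _
  rw [ENNReal.toReal_ofReal (mul_nonneg (angleConst_pos hν).le h0)]
  ring

/-- The integral of `cos^p sin^(2ν)` over `(0, π)`. -/
def cosSinIntegral (ν : ℝ) (p : ℕ) : ℝ :=
  ∫ θ in (0 : ℝ)..Real.pi, Real.cos θ ^ p * Real.sin θ ^ (2 * ν)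

theorem continuous_cos_pow_mul_sin_rpow {a : ℝ} (ha : 0 ≤ a) (p : ℕ) :
    Continuous fun θ : ℝ => Real.cos θ ^ p * Real.sin θ ^ a :=
  (Real.continuous_cos.pow p).mul
    (Real.continuous_sin.rpow_const fun _ => Or.inr ha)

theorem cosSinIntegral_one {ν : ℝ} (hν : 0 ≤ ν) : cosSinIntegral ν 1 = 0 := by
  have h : ∫ θ in (0 : ℝ)..Real.pi, (2 * ν + 1) * (Real.cos θ ^ 1 * Real.sin θ ^ (2 * ν)) =
      Real.sin Real.pi ^ (2 * ν + 1) - Real.sin 0 ^ (2 * ν + 1) := by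
    refine intervalIntegral.integral_eq_sub_of_hasDerivAt_of_le Real.pi_pos.le
      (f := fun θ => Real.sin θ ^ (2 * ν + 1))
      (Real.continuous_sin.rpow_const fun _ => Or.inr (by linarith)).continuousOn
      (fun θ hθ => ?_)
      ((continuous_cos_pow_mul_sin_rpow (by linarith) 1).const_mul _ |>.intervalIntegrable _ _)
    refine ((Real.hasDerivAt_sin θ).rpow_const (p := 2 * ν + 1)
      (Or.inl (Real.sin_pos_of_mem_Ioo hθ).ne')).congr_deriv ?_
    rw [add_sub_cancel_right]
    ring
  rw [intervalIntegral.integral_const_mul] at h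
  simp only [Real.sin_pi, Real.sin_zero, sub_self] at h
  exact (mul_eq_zero.mp h).resolve_left (by linarith)

/-- Integrate the derivative of `cos^(p+1) sin^(2ν+1)` over `(0, π)`. The boundary terms vanish
because `2ν + 1 > 0`. -/
theorem cosSinIntegral_add_two {ν : ℝ} (hν : 0 ≤ ν) (p : ℕ) :
    ((p : ℝ) + 2 + 2 * ν) * cosSinIntegral ν (p + 2) = (p + 1) * cosSinIntegral ν p := by
  have hc (q : ℕ) := (continuous_cos_pow_mul_sin_rpow (a := 2 * ν) (by linarith) q)
  have hi (q : ℕ) (a : ℝ) : IntervalIntegrable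
      (fun θ => a * (Real.cos θ ^ q * Real.sin θ ^ (2 * ν))) volume 0 Real.pi :=
    ((hc q).const_mul a).intervalIntegrable _ _
  have h : ∫ θ in (0 : ℝ)..Real.pi,
      (((p : ℝ) + 2 + 2 * ν) * (Real.cos θ ^ (p + 2) * Real.sin θ ^ (2 * ν)) -
        ((p : ℝ) + 1) * (Real.cos θ ^ p * Real.sin θ ^ (2 * ν))) =
      Real.cos Real.pi ^ (p + 1) * Real.sin Real.pi ^ (2 * ν + 1) -
        Real.cos 0 ^ (p + 1) * Real.sin 0 ^ (2 * ν + 1) := by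
    refine intervalIntegral.integral_eq_sub_of_hasDerivAt_of_le Real.pi_pos.le
      (f := fun θ => Real.cos θ ^ (p + 1) * Real.sin θ ^ (2 * ν + 1))
      (continuous_cos_pow_mul_sin_rpow (by linarith) _).continuousOn
      (fun θ hθ => ?_) ((hi _ _).sub (hi _ _))
    have hs := Real.sin_pos_of_mem_Ioo hθ
    refine (((Real.hasDerivAt_cos θ).fun_pow (p + 1)).fun_mul
      ((Real.hasDerivAt_sin θ).rpow_const (p := 2 * ν + 1) (Or.inl hs.ne'))).congr_deriv ?_
    rw [add_sub_cancel_right, Real.rpow_add hs, Real.rpow_one]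
    have e : Real.sin θ * Real.sin θ = 1 - Real.cos θ ^ 2 := by
      rw [← Real.sin_sq_add_cos_sq θ]; ring
    simp only [Nat.add_sub_cancel]
    push_cast
    linear_combination (-((p : ℝ) + 1) * Real.cos θ ^ p * Real.sin θ ^ (2 * ν)) * e
  rw [intervalIntegral.integral_sub (hi _ _) (hi _ _), intervalIntegral.integral_const_mul,
    intervalIntegral.integral_const_mul, Real.sin_pi, Real.sin_zero,
    Real.zero_rpow (by linarith), mul_zero, mul_zero, sub_zero] at h
  exact sub_eq_zero.mp h

theorem cosSinIntegral_zero_add_one {ν : ℝ} (hν : 0 ≤ ν) :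
    cosSinIntegral (ν + 1) 0 = (2 * ν + 1) / (2 * ν + 2) * cosSinIntegral ν 0 := by
  have hi (q : ℕ) : IntervalIntegrable
      (fun θ => (Real.cos θ ^ q * Real.sin θ ^ (2 * ν))) volume 0 Real.pi :=
    (continuous_cos_pow_mul_sin_rpow (by linarith) q).intervalIntegrable _ _
  have h : cosSinIntegral (ν + 1) 0 = cosSinIntegral ν 0 - cosSinIntegral ν 2 := by
    rw [cosSinIntegral, cosSinIntegral, cosSinIntegral,
      ← intervalIntegral.integral_sub (hi _) (hi _)]
    refine intervalIntegral.integral_congr fun θ hθ => ?_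
    rw [Set.uIcc_of_le Real.pi_pos.le] at hθ
    have hs := Real.sin_nonneg_of_mem_Icc hθ
    have e := Real.sin_sq_add_cos_sq θ
    rw [mul_add, mul_one, Real.rpow_add' hs (by linarith), Real.rpow_two]
    linear_combination Real.sin θ ^ (2 * ν) * e
  have h2 := cosSinIntegral_add_two hν 0
  rw [h]
  simp only [Nat.cast_zero, zero_add] at h2
  field_simp
  linear_combination -h2

theorem angleConst_add_one {ν : ℝ} (hν : 0 ≤ ν) :
    angleConst (ν + 1) = (2 * ν + 2) / (2 * ν + 1) * angleConst ν := by
  have h2 := Real.Gamma_pos_of_pos (by linarith : 0 < ν + 1 / 2)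
  have hpi := Real.pi_pos
  rw [angleConst, angleConst, Real.Gamma_add_one (by linarith : ν + 1 ≠ 0),
    show ν + 1 + 1 / 2 = (ν + 1 / 2) + 1 by ring,
    Real.Gamma_add_one (by linarith : ν + 1 / 2 ≠ 0)]
  field_simp

/-- Raising `ν` by one multiplies the constant and the integral by inverse factors, so the cases `ν
= 0` and `ν = 1/2` suffice for all half-integers. These cover every `v_m`. In part (i) the
normalization for real `ν` is inherited from the random variables `θ j`, whose law is `angleLaw ν`.
-/
theorem angleConst_mul_cosSinIntegral_natCast_div_two (n : ℕ) :
    angleConst ((n : ℝ) / 2) * cosSinIntegral ((n : ℝ) / 2) 0 = 1 := by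
  have hpi := Real.pi_pos
  induction n using Nat.twoStepInduction with
  | zero =>
    simp only [angleConst, cosSinIntegral, Nat.cast_zero, zero_div, mul_zero, Real.rpow_zero,
      pow_zero, mul_one, zero_add, Real.Gamma_one, Real.Gamma_one_half_eq,
      intervalIntegral.integral_const, sub_zero, smul_eq_mul]
    rw [Real.mul_self_sqrt hpi.le]
    field_simp
  | one =>
    have e : ∫ θ in (0 : ℝ)..Real.pi, Real.sin θ = 2 := by
      rw [integral_sin]; norm_num
    simp only [angleConst, cosSinIntegral, Nat.cast_one, pow_zero, one_mul,
      mul_one_div_cancel (two_ne_zero : (2 : ℝ) ≠ 0), Real.rpow_one, e]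
    rw [add_comm, show (1 : ℝ) + 1 / 2 = 1 / 2 + 1 by ring, Real.Gamma_add_one (by norm_num),
      Real.Gamma_one_half_eq]
    norm_num
    field_simp
  | more n ih _ =>
    have hn : (0 : ℝ) ≤ (n : ℝ) / 2 := by positivity
    rw [show ((n + 2 : ℕ) : ℝ) / 2 = (n : ℝ) / 2 + 1 by push_cast; ring,
      angleConst_add_one hn, cosSinIntegral_zero_add_one hn, ← ih]
    field_simp

theorem integral_cos_pow_angleLaw {ν : ℝ} (hν : 0 ≤ ν) (p : ℕ) :
    ∫ θ, Real.cos θ ^ p ∂angleLaw ν = angleConst ν * cosSinIntegral ν p :=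
  integral_angleLaw hν _

theorem angleLaw_univ {ν : ℝ} (hν : 0 ≤ ν) :
    angleLaw ν Set.univ = ENNReal.ofReal (angleConst ν * cosSinIntegral ν 0) := by
  rw [angleLaw, withDensity_apply _ MeasurableSet.univ, Measure.restrict_univ,
    ← ofReal_integral_eq_lintegral_ofReal]
  · congr 1
    rw [cosSinIntegral, intervalIntegral.integral_of_le Real.pi_pos.le,
      integral_Ioc_eq_integral_Ioo, integral_const_mul]
    simp [angleConst]
  · have h := ((continuous_cos_pow_mul_sin_rpow (by linarith : 0 ≤ 2 * ν) 0).const_mul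
      (Real.Gamma (ν + 1) / (√Real.pi * Real.Gamma (ν + 1 / 2)))).continuousOn
      (s := Set.Icc 0 Real.pi) |>.integrableOn_Icc (μ := volume)
    simp only [pow_zero, one_mul] at h
    exact h.mono_set Set.Ioo_subset_Icc_self
  · filter_upwards [ae_restrict_mem measurableSet_Ioo] with θ hθ
    exact mul_nonneg (angleConst_pos hν).le
      (Real.rpow_nonneg (Real.sin_pos_of_mem_Ioo hθ).le _)

theorem isProbabilityMeasure_angleLaw_natCast_div_two (n : ℕ) :
    IsProbabilityMeasure (angleLaw ((n : ℝ) / 2)) := by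
  constructor
  rw [angleLaw_univ (by positivity), angleConst_mul_cosSinIntegral_natCast_div_two]
  simp

/-- Legendre's duplication formula. At `ν = 0` it is the convention `1 / π` in `densityConst` that
makes the identity true. -/
theorem angleConst_eq {ν : ℝ} (hν : 0 ≤ ν) :
    angleConst ν = densityConst ν * 2 ^ (2 * ν) := by
  have hpi := Real.pi_pos
  rcases hν.eq_or_lt with rfl | h
  · simp only [angleConst, densityConst, zero_add, Real.Gamma_one, Real.Gamma_one_half_eq,
      mul_zero, Real.rpow_zero, if_true]
    rw [Real.mul_self_sqrt hpi.le, mul_one]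
  · rw [angleConst, densityConst, if_neg h.ne']
    have h1 := Real.Gamma_mul_Gamma_add_half ν
    rw [Real.rpow_sub two_pos, Real.rpow_one] at h1
    have h2 := Real.Gamma_pos_of_pos (by linarith : 0 < ν + 1 / 2)
    have h3 := Real.Gamma_pos_of_pos (by linarith : 0 < 2 * ν)
    have h4 : (0 : ℝ) < 2 ^ (2 * ν) := by positivity
    have h5 := Real.sq_sqrt hpi.le
    have h6 : 0 < √Real.pi := Real.sqrt_pos.mpr hpi
    field_simp at h1 ⊢
    rw [mul_comm 2 ν] at *
    linear_combination (-√Real.pi) * h1 - 2 * Real.Gamma (ν * 2) * h5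

/-- If `θ` has law `angleLaw ν`, then `r cos θ` has density
`densityConst ν * (2 / r)^(2ν) * (r^2 - x^2)^(ν - 1/2)` on `(-r, r)`. -/
theorem map_mul_cos_angleLaw {ν r : ℝ} (hν : 0 ≤ ν) (hr : 0 < r) :
    (angleLaw ν).map (fun θ => r * Real.cos θ) = conditionalDensityLaw ν r := by
  have himg : (fun θ => r * Real.cos θ) '' Set.Ioo 0 Real.pi = Set.Ioo (-r) r := by
    ext x
    constructor
    · rintro ⟨θ, hθ, rfl⟩
      have h1 : Real.cos θ < 1 := by
        simpa using Real.cos_lt_cos_of_nonneg_of_le_pi le_rfl hθ.2.le hθ.1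
      have h2 : -1 < Real.cos θ := by
        simpa using Real.cos_lt_cos_of_nonneg_of_le_pi hθ.1.le le_rfl hθ.2
      constructor <;> simp only <;> nlinarith
    · rintro ⟨h1, h2⟩
      have h3 : -1 < x / r := by rw [lt_div_iff₀ hr]; linarith
      have h4 : x / r < 1 := by rw [div_lt_one hr]; exact h2
      refine ⟨Real.arccos (x / r), ⟨Real.arccos_pos.mpr h4, ?_⟩, ?_⟩
      · refine lt_of_le_of_ne (Real.arccos_le_pi _) fun h => ?_
        rw [Real.arccos_eq_pi] at h
        linarith
      · simp only
        rw [Real.cos_arccos h3.le h4.le]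
        field_simp
  have hinj : Set.InjOn (fun θ => r * Real.cos θ) (Set.Ioo 0 Real.pi) := fun x hx y hy h =>
    Real.injOn_cos (Set.Ioo_subset_Icc_self hx) (Set.Ioo_subset_Icc_self hy)
      (mul_left_cancel₀ hr.ne' h)
  ext s hs
  have hm : Measurable fun θ => r * Real.cos θ := by fun_prop
  rw [Measure.map_apply hm hs, angleLaw, conditionalDensityLaw, withDensity_apply _ (hm hs),
    withDensity_apply _ hs, ← lintegral_indicator (hm hs), ← lintegral_indicator hs, ← himg,
    lintegral_image_eq_lintegral_abs_deriv_mul measurableSet_Ioo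
      (fun θ _ => ((Real.hasDerivAt_cos θ).const_mul r).hasDerivWithinAt) hinj]
  refine setLIntegral_congr_fun measurableSet_Ioo fun θ hθ => ?_
  have hsin := Real.sin_pos_of_mem_Ioo hθ
  by_cases hx : r * Real.cos θ ∈ s
  · rw [Set.indicator_of_mem (by exact hx), Set.indicator_of_mem hx,
      ← ENNReal.ofReal_mul (abs_nonneg _)]
    congr 1
    change angleConst ν * _ = _
    have e : r ^ 2 - (r * Real.cos θ) ^ 2 = (r * Real.sin θ) ^ 2 := by
      have := Real.sin_sq_add_cos_sq θ
      linear_combination (-r ^ 2) * this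
    have hrs : 0 < r * Real.sin θ := by positivity
    -- The density contributes `(r sin θ)^(2ν-1)` and the Jacobian `r sin θ` restores the exponent
    -- `2ν`.
    rw [angleConst_eq hν, e, ← Real.rpow_natCast (r * Real.sin θ) 2, ← Real.rpow_mul hrs.le,
      mul_neg, abs_neg, abs_of_pos hrs, Real.div_rpow two_pos.le hr.le,
      show ((2 : ℕ) : ℝ) * (ν - 1 / 2) = 2 * ν - 1 by push_cast; ring,
      Real.rpow_sub_one hrs.ne', Real.mul_rpow hr.le hsin.le]
    have := Real.rpow_pos_of_pos hr (2 * ν)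
    field_simp
  · rw [Set.indicator_of_notMem (by exact hx), Set.indicator_of_notMem hx, mul_zero]

/-! ### Gaussian integrals and coordinates of uniform directions. -/

theorem integrable_pow_mul_exp_neg_sq (p : ℕ) :
    Integrable fun x : ℝ => x ^ p * Real.exp (-x ^ 2) := by
  have hp : (-1 : ℝ) < p := by
    have : (0 : ℝ) ≤ p := p.cast_nonneg
    linarith
  simpa [Real.rpow_natCast] using integrable_rpow_mul_exp_neg_mul_sq one_pos hp

theorem hasDerivAt_exp_neg_sq (x : ℝ) :
    HasDerivAt (fun x : ℝ => Real.exp (-x ^ 2)) (Real.exp (-x ^ 2) * -(2 * x)) x := by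
  simpa using (hasDerivAt_pow 2 x).fun_neg.exp

theorem integral_id_mul_exp_neg_sq : ∫ x : ℝ, x ^ 1 * Real.exp (-x ^ 2) = 0 := by
  have h := integral_eq_zero_of_hasDerivAt_of_integrable
    (f' := fun x => -2 * (x ^ 1 * Real.exp (-x ^ 2)))
    (fun x => (hasDerivAt_exp_neg_sq x).congr_deriv (by ring))
    ((integrable_pow_mul_exp_neg_sq 1).const_mul _)
    (by simpa using integrable_pow_mul_exp_neg_sq 0)
  rw [integral_const_mul] at h
  linarith

theorem integral_pow_add_two_mul_exp_neg_sq (p : ℕ) :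
    2 * ∫ x : ℝ, x ^ (p + 2) * Real.exp (-x ^ 2) =
      (p + 1) * ∫ x : ℝ, x ^ p * Real.exp (-x ^ 2) := by
  have hi (q : ℕ) (a : ℝ) := (integrable_pow_mul_exp_neg_sq q).const_mul a
  have h := integral_eq_zero_of_hasDerivAt_of_integrable
    (f := fun x : ℝ => x ^ (p + 1) * Real.exp (-x ^ 2))
    (f' := fun x => ((p : ℝ) + 1) * (x ^ p * Real.exp (-x ^ 2)) -
      2 * (x ^ (p + 2) * Real.exp (-x ^ 2)))
    (fun x => ((hasDerivAt_pow (p + 1) x).fun_mul (hasDerivAt_exp_neg_sq x)).congr_deriv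
      (by push_cast [Nat.add_sub_cancel]; ring))
    ((hi _ _).sub (hi _ _)) (integrable_pow_mul_exp_neg_sq _)
  rw [integral_sub (hi _ _) (hi _ _), integral_const_mul, integral_const_mul] at h
  linarith

theorem integral_Ioi_pow_mul_exp_neg_sq (q : ℕ) :
    ∫ r in Set.Ioi (0 : ℝ), r ^ q * Real.exp (-r ^ 2) =
      (1 / 2) * Real.Gamma (((q : ℝ) + 1) / 2) := by
  have hq : (-1 : ℝ) < q := by
    have : (0 : ℝ) ≤ q := q.cast_nonneg
    linarith
  simpa [Real.rpow_natCast] using integral_rpow_mul_exp_neg_rpow two_pos hq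

theorem integral_Ioi_pow_add_two_mul_exp_neg_sq (q : ℕ) :
    2 * ∫ r in Set.Ioi (0 : ℝ), r ^ (q + 2) * Real.exp (-r ^ 2) =
      (q + 1) * ∫ r in Set.Ioi (0 : ℝ), r ^ q * Real.exp (-r ^ 2) := by
  have hq : ((q : ℝ) + 1) / 2 ≠ 0 := by positivity
  rw [integral_Ioi_pow_mul_exp_neg_sq, integral_Ioi_pow_mul_exp_neg_sq,
    show (((q + 2 : ℕ) : ℝ) + 1) / 2 = ((q : ℝ) + 1) / 2 + 1 by push_cast; ring,
    Real.Gamma_add_one hq]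
  ring

theorem integral_Ioi_pow_mul_exp_neg_sq_pos (q : ℕ) :
    0 < ∫ r in Set.Ioi (0 : ℝ), r ^ q * Real.exp (-r ^ 2) := by
  rw [integral_Ioi_pow_mul_exp_neg_sq]
  have := Real.Gamma_pos_of_pos (by positivity : 0 < ((q : ℝ) + 1) / 2)
  positivity

theorem integral_coord_pow_mul_exp_neg_norm_sq (d p : ℕ) :
    ∫ x : EuclideanSpace ℝ (Fin (d + 1)), x 0 ^ p * Real.exp (-‖x‖ ^ 2) =
      (∫ x : ℝ, x ^ p * Real.exp (-x ^ 2)) * (∫ x : ℝ, Real.exp (-x ^ 2)) ^ d := by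
  rw [← (EuclideanSpace.volume_preserving_symm_measurableEquiv_toLp (Fin (d + 1))).symm.integral_comp
    (MeasurableEquiv.measurableEmbedding _)]
  have e (x : Fin (d + 1) → ℝ) :
      ((MeasurableEquiv.toLp 2 (Fin (d + 1) → ℝ)).symm.symm x) 0 ^ p *
        Real.exp (-‖(MeasurableEquiv.toLp 2 (Fin (d + 1) → ℝ)).symm.symm x‖ ^ 2) =
      -- The Gaussian splits over the coordinates, and only the factor at index `0` carries the
      -- power `p`.
      ∏ i, Fin.cases (motive := fun _ => ℝ → ℝ) (fun y => y ^ p * Real.exp (-y ^ 2))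
        (fun _ y => Real.exp (-y ^ 2)) i (x i) := by
    rw [EuclideanSpace.norm_sq_eq, Fin.prod_univ_succ]
    simp only [Fin.cases_zero, Fin.cases_succ, Real.norm_eq_abs, sq_abs]
    rw [← Real.exp_sum, mul_assoc, ← Real.exp_add, Fin.sum_univ_succ]
    congr 2
    rw [Finset.sum_neg_distrib, neg_add]
    rfl
  simp_rw [e]
  rw [integral_fintype_prod_volume_eq_prod, Fin.prod_univ_succ]
  simp

/-- Polar coordinates: homogeneity turns `f` into `r^p` times its value on the sphere, and the
Jacobian supplies the remaining power of `r`. -/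
theorem integral_homogeneous_mul_radial {E : Type*} [NormedAddCommGroup E] [NormedSpace ℝ E]
    [MeasurableSpace E] [BorelSpace E] [FiniteDimensional ℝ E] [Nontrivial E]
    (μ : Measure E) [μ.IsAddHaarMeasure] (f : E → ℝ) (g : ℝ → ℝ) (p : ℕ)
    (hf : ∀ (r : ℝ) (x : E), f (r • x) = r ^ p * f x) :
    ∫ x, f x * g ‖x‖ ∂μ = (∫ v, f v ∂μ.toSphere) *
      ∫ r in Set.Ioi (0 : ℝ), r ^ (Module.finrank ℝ E - 1 + p) * g r := by
  calc
    ∫ x, f x * g ‖x‖ ∂μ = ∫ x : ({(0)}ᶜ : Set E), f x.1 * g ‖x.1‖ ∂(μ.comap (↑)) := by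
      rw [integral_subtype_comap (measurableSet_singleton _).compl fun x => f x * g ‖x‖,
        restrict_compl_singleton]
    _ = ∫ x, f x.1 * ((x.2 : ℝ) ^ p * g x.2)
          ∂μ.toSphere.prod (.volumeIoiPow (Module.finrank ℝ E - 1)) := by
      rw [← μ.measurePreserving_homeomorphUnitSphereProd.integral_comp
        (Homeomorph.measurableEmbedding _)]
      refine integral_congr_ae (ae_of_all _ fun x => ?_)
      have hx : ‖(x : E)‖ ≠ 0 := norm_ne_zero_iff.mpr x.2
      simp only [homeomorphUnitSphereProd_apply_fst_coe, homeomorphUnitSphereProd_apply_snd_coe,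
        hf, inv_pow]
      field_simp
    _ = (∫ v, f v ∂μ.toSphere) * ∫ x : Set.Ioi (0 : ℝ), (x : ℝ) ^ p * g x
          ∂.volumeIoiPow (Module.finrank ℝ E - 1) :=
      integral_prod_mul (fun v : Metric.sphere (0 : E) 1 => f v)
        (fun x : Set.Ioi (0 : ℝ) => (x : ℝ) ^ p * g x)
    _ = _ := by
      congr 1
      simp only [Measure.volumeIoiPow, ENNReal.ofReal]
      rw [integral_withDensity_eq_integral_smul,
        integral_subtype_comap measurableSet_Ioi
          fun a : ℝ => Real.toNNReal (a ^ (Module.finrank ℝ E - 1)) • (a ^ p * g a)]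
      · refine setIntegral_congr_fun measurableSet_Ioi fun x hx => ?_
        have hx : 0 < x := hx
        rw [NNReal.smul_def, Real.coe_toNNReal _ (by positivity), smul_eq_mul, pow_add]
        ring
      · exact (measurable_subtype_coe.pow_const _).real_toNNReal

instance isProbabilityMeasure_uniformDirection (d : ℕ) :
    IsProbabilityMeasure (uniformDirection (d + 1)) := by
  constructor
  rw [uniformDirection, Measure.smul_apply, smul_eq_mul]
  refine ENNReal.inv_mul_cancel ?_ (measure_ne_top _ _)
  rw [Measure.measure_univ_ne_zero]
  exact Measure.toSphere_ne_zero _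

/-- The Gaussian integral of `x 0 ^ p` is computed by Fubini and by polar coordinates. The constant
`C` collects the factors independent of `p`; it cancels when successive moments are compared. -/
theorem integral_coord_pow_uniformDirection (d : ℕ) :
    ∃ C : ℝ, C ≠ 0 ∧ ∀ p : ℕ, (∫ v, (v : EuclideanSpace ℝ (Fin (d + 1))) 0 ^ p
        ∂uniformDirection (d + 1)) * ∫ r in Set.Ioi (0 : ℝ), r ^ (d + p) * Real.exp (-r ^ 2) =
      C * ∫ x : ℝ, x ^ p * Real.exp (-x ^ 2) := by
  refine ⟨(((volume : Measure (EuclideanSpace ℝ (Fin (d + 1)))).toSphere Set.univ)⁻¹).toReal *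
    (∫ x : ℝ, Real.exp (-x ^ 2)) ^ d, ?_, fun p => ?_⟩
  · have h : (∫ x : ℝ, Real.exp (-x ^ 2)) = √(Real.pi / 1) := by
      simpa using integral_gaussian 1
    have hpi : 0 < √(Real.pi / 1) := Real.sqrt_pos.mpr (by simpa using Real.pi_pos)
    rw [h]
    refine mul_ne_zero (ENNReal.toReal_ne_zero.mpr ⟨?_, ?_⟩) (by positivity)
    · exact ENNReal.inv_ne_zero.mpr (measure_ne_top _ _)
    · rw [ENNReal.inv_ne_top, Measure.measure_univ_ne_zero]
      exact Measure.toSphere_ne_zero _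
  · have h := integral_homogeneous_mul_radial
      (volume : Measure (EuclideanSpace ℝ (Fin (d + 1)))) (fun x => x 0 ^ p)
      (fun r => Real.exp (-r ^ 2)) p (fun r x => by simp [mul_pow])
    rw [integral_coord_pow_mul_exp_neg_norm_sq, finrank_euclideanSpace_fin,
      Nat.add_sub_cancel] at h
    rw [uniformDirection, integral_smul_measure, smul_eq_mul, mul_assoc, ← h]
    ring

/-- The moments of `cos θ` under `angleLaw ν` are determined by a two-step recursion. -/
theorem integral_cos_pow_angleLaw_eq_of_recursion {ν : ℝ} (hν : 0 ≤ ν)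
    [IsProbabilityMeasure (angleLaw ν)] {m : ℕ → ℝ} (h0 : m 0 = 1) (h1 : m 1 = 0)
    (h : ∀ p : ℕ, ((p : ℝ) + 2 + 2 * ν) * m (p + 2) = (p + 1) * m p) (p : ℕ) :
    ∫ θ, Real.cos θ ^ p ∂angleLaw ν = m p := by
  induction p using Nat.twoStepInduction with
  | zero => simp [h0]
  | one => rw [integral_cos_pow_angleLaw hν, cosSinIntegral_one hν, mul_zero, h1]
  | more p ih _ =>
    have hp : (p : ℝ) + 2 + 2 * ν ≠ 0 := by positivity
    refine mul_left_cancel₀ hp ?_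
    rw [h, ← ih, integral_cos_pow_angleLaw hν, integral_cos_pow_angleLaw hν]
    linear_combination angleConst ν * cosSinIntegral_add_two hν p

theorem ae_abs_le_one_map_cos (μ : Measure ℝ) : ∀ᵐ x ∂μ.map Real.cos, |x| ≤ 1 := by
  rw [ae_map_iff (by fun_prop) (measurableSet_le (by fun_prop) (by fun_prop))]
  exact ae_of_all _ Real.abs_cos_le_one

/-- A coordinate of a uniform direction in dimension `2ν + 2` has the law of `cos θ`. -/
theorem map_coord_uniformDirection {ν : ℝ} (hν : 0 ≤ ν) [IsProbabilityMeasure (angleLaw ν)]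
    (d : ℕ) (hd : (d : ℝ) = 2 * ν + 1) :
    (uniformDirection (d + 1)).map
        (fun v : Metric.sphere (0 : EuclideanSpace ℝ (Fin (d + 1))) 1 =>
          (v : EuclideanSpace ℝ (Fin (d + 1))) 0) =
      (angleLaw ν).map Real.cos := by
  have hm : Measurable fun v : Metric.sphere (0 : EuclideanSpace ℝ (Fin (d + 1))) 1 =>
    (v : EuclideanSpace ℝ (Fin (d + 1))) 0 := by fun_prop
  have := Measure.isProbabilityMeasure_map (μ := uniformDirection (d + 1)) hm.aemeasurable
  have := Measure.isProbabilityMeasure_map (μ := angleLaw ν) Real.measurable_cos.aemeasurable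
  refine ext_of_integral_pow (R := 1) ?_ (ae_abs_le_one_map_cos _) fun p => ?_
  · rw [ae_map_iff hm.aemeasurable (measurableSet_le (by fun_prop) (by fun_prop))]
    refine ae_of_all _ fun v => ?_
    have h := PiLp.norm_apply_le (v : EuclideanSpace ℝ (Fin (d + 1))) 0
    rwa [norm_eq_of_mem_sphere] at h
  · rw [integral_map hm.aemeasurable (by fun_prop), integral_map (by fun_prop) (by fun_prop)]
    obtain ⟨C, hC, h⟩ := integral_coord_pow_uniformDirection d
    symm
    refine integral_cos_pow_angleLaw_eq_of_recursion hν (m := fun p => ∫ v,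
      (v : EuclideanSpace ℝ (Fin (d + 1))) 0 ^ p ∂uniformDirection (d + 1)) (by simp) ?_ ?_ p
    · have := h 1
      rw [integral_id_mul_exp_neg_sq, mul_zero] at this
      exact (mul_eq_zero.mp this).resolve_right (integral_Ioi_pow_mul_exp_neg_sq_pos _).ne'
    · intro p
      have e1 := h p
      have e2 := h (p + 2)
      have e3 := integral_pow_add_two_mul_exp_neg_sq p
      have e4 := integral_Ioi_pow_add_two_mul_exp_neg_sq (d + p)
      have e5 := integral_Ioi_pow_mul_exp_neg_sq_pos (d + p)
      rw [← add_assoc] at e2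
      push_cast at e4
      refine mul_right_cancel₀ e5.ne' ?_
      simp only
      set A := ∫ v, (v : EuclideanSpace ℝ (Fin (d + 1))) 0 ^ p ∂uniformDirection (d + 1)
      set B := ∫ v, (v : EuclideanSpace ℝ (Fin (d + 1))) 0 ^ (p + 2) ∂uniformDirection (d + 1)
      -- The radial integrals gain `(d+p+1)/2` and the one-dimensional ones `(p+1)/2` from `p` to
      -- `p+2`. The quotient is the recursion of `angleLaw ν` exactly when `d + 1 = 2ν + 2`.
      rw [show (p : ℝ) + 2 + 2 * ν = d + p + 1 by rw [hd]; ring]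
      linear_combination 2 * e2 - B * e4 + C * e3 - (p + 1) * e1

/-! ### Powers of the moment series and their differential equations. -/

/-- The Euler operator `z d/dz` on power series. -/
def eulerOp : PowerSeries ℝ →ₗ[ℝ] PowerSeries ℝ :=
  LinearMap.mulLeft ℝ PowerSeries.X ∘ₗ (PowerSeries.derivative ℝ).toLinearMap

theorem eulerOp_apply (f : PowerSeries ℝ) :
    eulerOp f = PowerSeries.X * PowerSeries.derivative ℝ f := rfl

theorem coeff_eulerOp (f : PowerSeries ℝ) (p : ℕ) :
    PowerSeries.coeff p (eulerOp f) = p * PowerSeries.coeff p f := by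
  rw [eulerOp_apply]
  cases p with
  | zero => simp
  | succ p =>
    rw [PowerSeries.coeff_succ_X_mul, PowerSeries.coeff_derivative]
    push_cast
    ring

theorem eulerOp_mul (f g : PowerSeries ℝ) :
    eulerOp (f * g) = f * eulerOp g + g * eulerOp f := by
  simp only [eulerOp_apply, Derivation.leibniz, smul_eq_mul]
  ring

/-- The extra factor `f` avoids the exponent `n - 1`; it is cancelled later, power series over `ℝ`
being a domain. -/
theorem eulerOp_pow (f : PowerSeries ℝ) (n : ℕ) :
    f * eulerOp (f ^ n) = n * f ^ n * eulerOp f := by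
  induction n with
  | zero => simp [eulerOp_apply]
  | succ n ih =>
    rw [pow_succ, eulerOp_mul, mul_add, mul_left_comm, ih]
    push_cast
    ring

theorem eulerOp_X_pow (n : ℕ) :
    eulerOp (PowerSeries.X ^ n) = (n : PowerSeries ℝ) * PowerSeries.X ^ n := by
  cases n with
  | zero => simp [eulerOp_apply]
  | succ n =>
    simp only [eulerOp_apply, Derivation.leibniz_pow, PowerSeries.derivative_X]
    simp only [Nat.add_sub_cancel, smul_eq_mul, nsmul_eq_mul, mul_one]
    push_cast
    ring

theorem eulerOp_one : eulerOp 1 = 0 := by simpa using eulerOp_X_pow 0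

theorem coeff_X_sq_mul_add_two (f : PowerSeries ℝ) (p : ℕ) :
    PowerSeries.coeff (p + 2) (PowerSeries.X ^ 2 * f) = PowerSeries.coeff p f :=
  PowerSeries.coeff_X_pow_mul f 2 p

theorem coeff_X_sq_mul_zero (f : PowerSeries ℝ) :
    PowerSeries.coeff 0 (PowerSeries.X ^ 2 * f) = 0 := by
  rw [PowerSeries.coeff_X_pow_mul']; simp

theorem coeff_X_sq_mul_one (f : PowerSeries ℝ) :
    PowerSeries.coeff 1 (PowerSeries.X ^ 2 * f) = 0 := by
  rw [PowerSeries.coeff_X_pow_mul']; simp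

theorem coeff_natCast_mul (n p : ℕ) (f : PowerSeries ℝ) :
    PowerSeries.coeff p ((n : PowerSeries ℝ) * f) = n * PowerSeries.coeff p f := by
  rw [← nsmul_eq_mul, map_nsmul, nsmul_eq_mul]

theorem powerSeries_eq_zero_of_coeff_recursion {f : PowerSeries ℝ} {a b : ℕ → ℝ}
    (h0 : PowerSeries.coeff 0 f = 0) (h1 : PowerSeries.coeff 1 f = 0) (ha : ∀ p, a p ≠ 0)
    (h : ∀ p, a p * PowerSeries.coeff (p + 2) f = b p * PowerSeries.coeff p f) : f = 0 := by
  ext p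
  induction p using Nat.twoStepInduction with
  | zero => simpa using h0
  | one => simpa using h1
  | more p ih _ =>
    have := h p
    rw [ih, map_zero, mul_zero] at this
    simpa using (mul_eq_zero.mp this).resolve_left (ha p)

/-- The generating series of the moments of `cos θ` under `angleLaw ν`. -/
def momentSeries (ν : ℝ) : PowerSeries ℝ :=
  PowerSeries.mk fun p => ∫ θ, Real.cos θ ^ p ∂angleLaw ν

theorem coeff_zero_momentSeries {ν : ℝ} [IsProbabilityMeasure (angleLaw ν)] :
    PowerSeries.coeff 0 (momentSeries ν) = 1 := by
  simp [momentSeries]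

theorem coeff_one_momentSeries {ν : ℝ} (hν : 0 ≤ ν) :
    PowerSeries.coeff 1 (momentSeries ν) = 0 := by
  rw [momentSeries, PowerSeries.coeff_mk, integral_cos_pow_angleLaw hν, cosSinIntegral_one hν,
    mul_zero]

theorem coeff_add_two_momentSeries {ν : ℝ} (hν : 0 ≤ ν) (p : ℕ) :
    ((p : ℝ) + 2 + 2 * ν) * PowerSeries.coeff (p + 2) (momentSeries ν) =
      (p + 1) * PowerSeries.coeff p (momentSeries ν) := by
  rw [momentSeries, PowerSeries.coeff_mk, PowerSeries.coeff_mk, integral_cos_pow_angleLaw hν,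
    integral_cos_pow_angleLaw hν]
  linear_combination angleConst ν * cosSinIntegral_add_two hν p

theorem coeff_zero_pow_of_coeff_zero_eq_one {f : PowerSeries ℝ}
    (h : PowerSeries.coeff 0 f = 1) (n : ℕ) : PowerSeries.coeff 0 (f ^ n) = 1 := by
  rw [PowerSeries.coeff_zero_eq_constantCoeff_apply] at *
  rw [map_pow, h, one_pow]

theorem coeff_one_pow_of_coeff_one_eq_zero {f : PowerSeries ℝ}
    (h : PowerSeries.coeff 1 f = 0) (n : ℕ) : PowerSeries.coeff 1 (f ^ n) = 0 := by
  induction n with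
  | zero => simp [PowerSeries.coeff_one]
  | succ n ih =>
    rw [pow_succ, PowerSeries.coeff_mul, Finset.Nat.antidiagonal_succ]
    simp [h, ih]

theorem ne_zero_of_coeff_zero_eq_one {f : PowerSeries ℝ} (h : PowerSeries.coeff 0 f = 1) :
    f ≠ 0 := by
  rintro rfl
  simp at h

theorem isProbabilityMeasure_angleLaw_zero : IsProbabilityMeasure (angleLaw 0) := by
  simpa using isProbabilityMeasure_angleLaw_natCast_div_two 0

theorem isProbabilityMeasure_angleLaw_natCast (n : ℕ) :
    IsProbabilityMeasure (angleLaw n) := by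
  have := isProbabilityMeasure_angleLaw_natCast_div_two (2 * n)
  rwa [show ((2 * n : ℕ) : ℝ) / 2 = n by push_cast; ring] at this

/-- The differential equation of `(1 - z^2)^(-n/2)`. -/
theorem eulerOp_momentSeries_zero_pow (n : ℕ) :
    (1 - PowerSeries.X ^ 2) * eulerOp (momentSeries 0 ^ n) =
      (n : PowerSeries ℝ) * (PowerSeries.X ^ 2 * momentSeries 0 ^ n) := by
  have := isProbabilityMeasure_angleLaw_zero
  set b := momentSeries 0 with hb
  have hode : (1 - PowerSeries.X ^ 2) * eulerOp b = PowerSeries.X ^ 2 * b := by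
    ext p
    rw [sub_mul, one_mul, map_sub]
    match p with
    | 0 => simp only [coeff_X_sq_mul_zero, coeff_eulerOp]; simp
    | 1 =>
      simp only [coeff_X_sq_mul_one, coeff_eulerOp, hb, coeff_one_momentSeries le_rfl]; simp
    | p + 2 =>
      simp only [coeff_X_sq_mul_add_two, coeff_eulerOp]
      have := coeff_add_two_momentSeries (le_refl (0 : ℝ)) p
      push_cast
      linear_combination this
  have hb0 : b ≠ 0 := ne_zero_of_coeff_zero_eq_one coeff_zero_momentSeries
  refine mul_left_cancel₀ hb0 ?_
  linear_combination (1 - PowerSeries.X ^ 2) * eulerOp_pow b n + n * b ^ n * hode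

theorem choose_add_two_mul (n p : ℕ) :
    ((n + (p + 2)).choose (p + 2) : ℝ) * ((p + 1) * (p + 2)) =
      (n + p + 1) * (n + p + 2) * (n + p).choose p := by
  have h1 := Nat.add_one_mul_choose_eq (n + p) p
  have h2 := Nat.add_one_mul_choose_eq (n + p + 1) (p + 1)
  rw [show n + p + 1 + 1 = n + (p + 2) by ring] at h2
  have h1' : ((n : ℝ) + p + 1) * (n + p).choose p = (n + p + 1).choose (p + 1) * (p + 1) := by
    exact_mod_cast h1
  have h2' : ((n : ℝ) + (p + 2)) * (n + p + 1).choose (p + 1) =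
      (n + (p + 2)).choose (p + 2) * (p + 1 + 1) := by
    exact_mod_cast h2
  linear_combination (-(p : ℝ) - 1) * h2' - (n + p + 2) * h1'

/-- The hypothesis on `F` is the product of the moment recursion with that of `C(n+p, p)`. A
two-step recursion with nonvanishing leading factor is determined by its first two values. -/
theorem coeff_eq_choose_mul_moment_of_recursion {ν : ℝ} (hν : 0 ≤ ν)
    [IsProbabilityMeasure (angleLaw ν)] (n : ℕ) {F : PowerSeries ℝ}
    (h0 : PowerSeries.coeff 0 F = 1) (h1 : PowerSeries.coeff 1 F = 0)
    (h : ∀ p : ℕ, ((p : ℝ) + 2) * (p + 2 + 2 * ν) * PowerSeries.coeff (p + 2) F =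
      (n + p + 1) * (n + p + 2) * PowerSeries.coeff p F) (p : ℕ) :
    PowerSeries.coeff p F = (n + p).choose p * ∫ θ, Real.cos θ ^ p ∂angleLaw ν := by
  change _ = _ * (fun p => ∫ θ, Real.cos θ ^ p ∂angleLaw ν) p
  simp only [← PowerSeries.coeff_mk p fun p => ∫ θ, Real.cos θ ^ p ∂angleLaw ν]
  change _ = _ * PowerSeries.coeff p (momentSeries ν)
  induction p using Nat.twoStepInduction with
  | zero => rw [h0, coeff_zero_momentSeries]; simp
  | one => rw [h1, coeff_one_momentSeries hν, mul_zero]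
  | more p ih _ =>
    have hp : ((p : ℝ) + 2) * (p + 2 + 2 * ν) ≠ 0 := by positivity
    refine mul_left_cancel₀ hp ?_
    have e1 := coeff_add_two_momentSeries hν p
    have e2 := choose_add_two_mul n p
    rw [h, ih]
    linear_combination (-PowerSeries.coeff p (momentSeries ν)) * e2 -
      (p + 2) * ((n + (p + 2)).choose (p + 2) : ℝ) * e1

theorem coeff_momentSeries_zero_pow (n p : ℕ) :
    PowerSeries.coeff p (momentSeries 0 ^ (n + 1)) =
      (n + p).choose p * ∫ θ, Real.cos θ ^ p ∂angleLaw ((n : ℝ) / 2) := by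
  have := isProbabilityMeasure_angleLaw_zero
  have := isProbabilityMeasure_angleLaw_natCast_div_two n
  refine coeff_eq_choose_mul_moment_of_recursion (by positivity) n
    (coeff_zero_pow_of_coeff_zero_eq_one coeff_zero_momentSeries _)
    (coeff_one_pow_of_coeff_one_eq_zero (coeff_one_momentSeries le_rfl) _) (fun p => ?_) p
  have h := congrArg (PowerSeries.coeff (p + 2)) (eulerOp_momentSeries_zero_pow (n + 1))
  rw [sub_mul, one_mul, map_sub, coeff_X_sq_mul_add_two, coeff_natCast_mul,
    coeff_X_sq_mul_add_two, coeff_eulerOp, coeff_eulerOp] at h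
  push_cast at h
  -- The differential equation gives `(p+2) F_(p+2) = (n+p+1) F_p`. The missing factor `n+p+2` is
  -- `p+2+2v` with `v = n/2`.
  linear_combination ((n : ℝ) + p + 2) * h

/-- This is the recursion `(p+4) m_(p+2) = (p+1) m_p` in generating form; the constant `2` balances
the coefficient of degree zero. -/
theorem eulerOp_momentSeries_one :
    (1 - PowerSeries.X ^ 2) * eulerOp (momentSeries 1) =
      2 - (2 - PowerSeries.X ^ 2) * momentSeries 1 := by
  have : IsProbabilityMeasure (angleLaw 1) := by
    simpa using isProbabilityMeasure_angleLaw_natCast 1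
  set b := momentSeries 1 with hb
  have e : ∀ f : PowerSeries ℝ, 2 * f = ((2 : ℕ) : PowerSeries ℝ) * f := fun f => by norm_num
  have e2 : (2 : PowerSeries ℝ) = ((2 : ℕ) : PowerSeries ℝ) * 1 := by norm_num
  have hone (p : ℕ) : PowerSeries.coeff (p + 2) (1 : PowerSeries ℝ) = 0 := by
    simp [PowerSeries.coeff_one]
  rw [sub_mul, sub_mul, one_mul]
  ext p
  rw [e, e2]
  simp only [map_sub, coeff_natCast_mul]
  match p with
  | 0 =>
    simp only [coeff_X_sq_mul_zero, coeff_eulerOp, hb, coeff_zero_momentSeries]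
    simp
  | 1 =>
    simp only [coeff_X_sq_mul_one, coeff_eulerOp, hb, coeff_one_momentSeries zero_le_one]
    simp [PowerSeries.coeff_one]
  | p + 2 =>
    simp only [coeff_X_sq_mul_add_two, coeff_eulerOp, hone]
    have := coeff_add_two_momentSeries (zero_le_one (α := ℝ)) p
    push_cast
    linear_combination this

/-- The series `momentSeries 1` is `2 (1 - √(1 - z^2)) / z^2`. -/
theorem momentSeries_one_quadratic :
    PowerSeries.X ^ 2 * momentSeries 1 ^ 2 = 4 * momentSeries 1 - 4 := by
  set b := momentSeries 1 with hb
  have hode : (1 - PowerSeries.X ^ 2) * eulerOp b = 2 - (2 - PowerSeries.X ^ 2) * b :=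
    eulerOp_momentSeries_one
  have hX : eulerOp (PowerSeries.X ^ 2) = 2 * PowerSeries.X ^ 2 := by
    simpa using eulerOp_X_pow 2
  have h4 : eulerOp 4 = 0 := by
    have : (4 : PowerSeries ℝ) = (4 : ℝ) • 1 := by
      rw [PowerSeries.smul_eq_C_mul, mul_one]; rfl
    rw [this, map_smul, eulerOp_one, smul_zero]
  -- With `S = 2 - z² b`, this is `u = S² - 4(1-z²)`. Both terms solve `(1-z²) z y' = -2z² y`, and
  -- the factor `z²` makes the first two coefficients of `u` vanish, which forces `u = 0`.
  set u : PowerSeries ℝ :=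
    PowerSeries.X ^ 2 * (PowerSeries.X ^ 2 * b ^ 2 - 4 * b + 4) with hu
  have hb2 : eulerOp (b ^ 2) = 2 * b * eulerOp b := by
    rw [pow_two, eulerOp_mul]; ring
  have hode' : (1 - PowerSeries.X ^ 2) * eulerOp u =
      ((2 : ℕ) : PowerSeries ℝ) * -(PowerSeries.X ^ 2 * u) := by
    rw [hu, eulerOp_mul, map_add, map_sub, eulerOp_mul, eulerOp_mul, hX, h4, hb2]
    push_cast
    linear_combination (PowerSeries.X ^ 2 * (2 * PowerSeries.X ^ 2 * b - 4)) * hode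
  have hu0 : u = 0 := by
    refine powerSeries_eq_zero_of_coeff_recursion (a := fun p => (p : ℝ) + 2)
      (b := fun p => (p : ℝ) - 2) (coeff_X_sq_mul_zero _) (coeff_X_sq_mul_one _)
      (fun p => by positivity) fun p => ?_
    have h := congrArg (PowerSeries.coeff (p + 2)) hode'
    rw [sub_mul, one_mul, map_sub, coeff_X_sq_mul_add_two, coeff_natCast_mul, map_neg,
      coeff_X_sq_mul_add_two, coeff_eulerOp, coeff_eulerOp] at h
    push_cast at h
    linear_combination h
  have hX0 : (PowerSeries.X ^ 2 : PowerSeries ℝ) ≠ 0 := pow_ne_zero _ PowerSeries.X_ne_zero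
  have := (mul_eq_zero.mp hu0).resolve_left hX0
  linear_combination this

/-- The second-order differential equation of the powers of `2 (1 - √(1 - z^2)) / z^2`. -/
theorem eulerOp_momentSeries_one_pow (r : ℕ) {E : PowerSeries ℝ}
    (hE : E = eulerOp (momentSeries 1 ^ r) + (r : PowerSeries ℝ) * momentSeries 1 ^ r) :
    (1 - PowerSeries.X ^ 2) * (eulerOp E + (r : PowerSeries ℝ) * E) - PowerSeries.X ^ 2 * E =
      (r : PowerSeries ℝ) ^ 2 * momentSeries 1 ^ r := by
  have : IsProbabilityMeasure (angleLaw 1) := by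
    simpa using isProbabilityMeasure_angleLaw_natCast 1
  have hb0 : momentSeries 1 ≠ 0 := ne_zero_of_coeff_zero_eq_one coeff_zero_momentSeries
  have hode := eulerOp_momentSeries_one
  have hq := momentSeries_one_quadratic
  have hpow := eulerOp_pow (momentSeries 1) r
  set b := momentSeries 1 with hb
  set F := b ^ r with hF
  -- `S` plays the role of `2√(1-z²)`. With it the powers satisfy the first-order equation `S (ϑ +
  -- r) F = 2 r F`, where `ϑ = z d/dz`. Applying `ϑ` once more and using `S² = 4(1-z²)` and `S ϑS =
  -- -4z²` removes the square root.
  set S : PowerSeries ℝ := 2 - PowerSeries.X ^ 2 * b with hS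
  have hS2 : S ^ 2 = 4 * (1 - PowerSeries.X ^ 2) := by
    rw [hS]; linear_combination PowerSeries.X ^ 2 * hq
  have hS0 : S ≠ 0 := by
    intro h
    have := congrArg (PowerSeries.coeff 0) h
    rw [hS, map_sub, coeff_X_sq_mul_zero, sub_zero, map_zero] at this
    have e2 : (2 : PowerSeries ℝ) = ((2 : ℕ) : PowerSeries ℝ) * 1 := by norm_num
    rw [e2, coeff_natCast_mul] at this
    simp at this
  have hSb : S * eulerOp b = b * (2 - S) := by
    refine mul_left_cancel₀ hS0 ?_
    rw [← mul_assoc, ← pow_two]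
    have : S * (b * (2 - S)) = 2 * b * S - b * S ^ 2 := by ring
    rw [this, hS2, hS]
    linear_combination 4 * hode + 2 * hq
  have hSF : S * eulerOp F = r * F * (2 - S) := by
    refine mul_left_cancel₀ hb0 ?_
    linear_combination S * hpow + r * F * hSb
  have hSE : S * E = 2 * r * F := by
    rw [hE]; linear_combination hSF
  have hX : eulerOp (PowerSeries.X ^ 2) = 2 * PowerSeries.X ^ 2 := by
    simpa using eulerOp_X_pow 2
  have hn (n : ℕ) (f : PowerSeries ℝ) : eulerOp ((n : PowerSeries ℝ) * f) = (n : PowerSeries ℝ) * eulerOp f := by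
    rw [← nsmul_eq_mul, map_nsmul, nsmul_eq_mul]
  have h2 : eulerOp 2 = 0 := by
    have := hn 2 1
    rw [eulerOp_one, mul_zero, mul_one] at this
    exact_mod_cast this
  have hSS : S * eulerOp S = -4 * PowerSeries.X ^ 2 := by
    have : eulerOp S = -(PowerSeries.X ^ 2 * eulerOp b + b * (2 * PowerSeries.X ^ 2)) := by
      rw [hS, map_sub, eulerOp_mul, hX, h2, zero_sub]
    rw [this]
    have : S * b = 2 * b - PowerSeries.X ^ 2 * b ^ 2 := by rw [hS]; ring
    linear_combination (-PowerSeries.X ^ 2) * hSb - PowerSeries.X ^ 2 * this +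
      PowerSeries.X ^ 2 * hq
  have hd := congrArg eulerOp hSE
  rw [eulerOp_mul, mul_assoc, show (2 : PowerSeries ℝ) = (2 : ℕ) by norm_num, hn, hn] at hd
  push_cast at hd
  have h40 : (4 : PowerSeries ℝ) ≠ 0 := by
    intro h
    have := congrArg PowerSeries.constantCoeff h
    rw [map_ofNat, map_zero] at this
    norm_num at this
  refine mul_left_cancel₀ h40 ?_
  linear_combination S * hd + r * S * hSE - E * hSS - (eulerOp E + r * E) * hS2 +
    2 * r * hSE - 2 * r * S * hE

theorem coeff_momentSeries_one_pow (n p : ℕ) :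
    PowerSeries.coeff p (momentSeries 1 ^ (n + 1)) =
      (n + p).choose p * ∫ θ, Real.cos θ ^ p ∂angleLaw ((n : ℝ) + 1) := by
  have : IsProbabilityMeasure (angleLaw 1) := by
    simpa using isProbabilityMeasure_angleLaw_natCast 1
  have : IsProbabilityMeasure (angleLaw ((n : ℝ) + 1)) := by
    simpa using isProbabilityMeasure_angleLaw_natCast (n + 1)
  refine coeff_eq_choose_mul_moment_of_recursion (by positivity) n
    (coeff_zero_pow_of_coeff_zero_eq_one coeff_zero_momentSeries _)
    (coeff_one_pow_of_coeff_one_eq_zero (coeff_one_momentSeries zero_le_one) _) (fun p => ?_) p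
  -- With `r = n + 1`, the leading factor is `(p+2+r)² - r² = (p+2)(p+2+2r)`, whence `v = n + 1`.
  have h := congrArg (PowerSeries.coeff (p + 2)) (eulerOp_momentSeries_one_pow (n + 1) rfl)
  have e : ((n + 1 : ℕ) : PowerSeries ℝ) ^ 2 = (((n + 1) ^ 2 : ℕ) : PowerSeries ℝ) := by
    push_cast; rfl
  rw [sub_mul, one_mul, map_sub, map_sub, e] at h
  simp only [coeff_X_sq_mul_add_two, coeff_natCast_mul, coeff_eulerOp, map_add] at h
  push_cast at h
  linear_combination h

/-! ### Independent sequences and the renewal structure. -/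

/-- The sequence `a, x 0, x 1, ...`. -/
def seqCons {α : Type*} (a : α) (x : ℕ → α) : ℕ → α
  | 0 => a
  | n + 1 => x n

theorem measurable_seqCons {α : Type*} [MeasurableSpace α] :
    Measurable fun q : α × (ℕ → α) => seqCons q.1 q.2 := by
  refine measurable_pi_lambda _ fun n => ?_
  cases n with
  | zero => exact measurable_fst
  | succ n => exact (measurable_pi_apply n).comp measurable_snd

theorem map_seqCons {α : Type*} [MeasurableSpace α] (μ : Measure α) [IsProbabilityMeasure μ] :
    (μ.prod (Measure.infinitePi fun _ : ℕ => μ)).map (fun q => seqCons q.1 q.2) =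
      Measure.infinitePi fun _ : ℕ => μ := by
  classical
  refine Measure.eq_infinitePi (X := fun _ : ℕ => α) (fun _ : ℕ => μ) fun s t ht => ?_
  obtain ⟨N, hN⟩ := s.exists_nat_subset_range
  have hN' : s ⊆ Finset.range (N + 1) :=
    hN.trans (Finset.range_subset_range.mpr (Nat.le_succ N))
  -- Padding with the whole space makes the index set an initial segment, which splits cleanly into
  -- index `0` and a shifted segment.
  set t' : ℕ → Set α := fun i => if i ∈ s then t i else Set.univ with ht'
  have hmt (i : ℕ) : MeasurableSet (t' i) := by
    simp only [ht']
    split_ifs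
    · exact ht i
    · exact .univ
  have e1 : (s : Set ℕ).pi t = (Finset.range (N + 1) : Set ℕ).pi t' := by
    ext x
    simp only [Set.mem_pi, Finset.mem_coe, ht']
    refine ⟨fun h i _ => ?_, fun h i hi => ?_⟩
    · split_ifs with his
      · exact h i his
      · trivial
    · simpa [hi] using h i (hN' hi)
  have e2 : (fun q : α × (ℕ → α) => seqCons q.1 q.2) ⁻¹' (Finset.range (N + 1) : Set ℕ).pi t' =
      t' 0 ×ˢ (Finset.range N : Set ℕ).pi (fun i => t' (i + 1)) := by
    ext ⟨a, x⟩
    simp only [Set.mem_preimage, Set.mem_pi, Finset.mem_coe, Finset.mem_range, Set.mem_prod]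
    constructor
    · exact fun h => ⟨h 0 (Nat.succ_pos _), fun i hi => h (i + 1) (Nat.succ_lt_succ hi)⟩
    · rintro ⟨h0, h⟩ (_ | i) hi
      · exact h0
      · exact h i (Nat.lt_of_succ_lt_succ hi)
  have e3 : ∏ i ∈ s, μ (t i) = ∏ i ∈ Finset.range (N + 1), μ (t' i) := by
    rw [← Finset.prod_subset hN' (f := fun i => μ (t' i))]
    · refine Finset.prod_congr rfl fun i hi => ?_
      simp [ht', hi]
    · intro i _ hi
      simp [ht', hi]
  rw [e1, e3, Measure.map_apply measurable_seqCons
    (MeasurableSet.pi (Finset.countable_toSet _) fun i _ => hmt i), e2, Measure.prod_prod,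
    Measure.infinitePi_pi _ (fun i _ => hmt (i + 1)), Finset.prod_range_succ', mul_comm]

/-- The joint law of independent i.i.d. sequences with marginals `τ` and `ρ`. -/
def markedSeqLaw {S : Type*} [MeasurableSpace S] (τ : Measure ℝ) [IsProbabilityMeasure τ]
    (ρ : Measure S) [IsProbabilityMeasure ρ] : Measure ((ℕ → ℝ) × (ℕ → S)) :=
  (Measure.infinitePi fun _ : ℕ => τ).prod (Measure.infinitePi fun _ : ℕ => ρ)

instance {S : Type*} [MeasurableSpace S] (τ : Measure ℝ) [IsProbabilityMeasure τ]
    (ρ : Measure S) [IsProbabilityMeasure ρ] : IsProbabilityMeasure (markedSeqLaw τ ρ) := by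
  unfold markedSeqLaw; infer_instance

/-- Prepends a pair to a pair of sequences. -/
def seqConsPair {S : Type*} (q : (ℝ × S) × ((ℕ → ℝ) × (ℕ → S))) : (ℕ → ℝ) × (ℕ → S) :=
  (seqCons q.1.1 q.2.1, seqCons q.1.2 q.2.2)

/-- The first leg is independent of the motion after it, which has the original law; this drives the
induction on the number of events. On rectangles the indicator factors into a part for the times and
a part for the marks. -/
theorem measurePreserving_seqConsPair {S : Type*} [MeasurableSpace S] (τ : Measure ℝ)
    [IsProbabilityMeasure τ] (ρ : Measure S) [IsProbabilityMeasure ρ] :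
    MeasurePreserving seqConsPair ((τ.prod ρ).prod (markedSeqLaw τ ρ)) (markedSeqLaw τ ρ) := by
  have hm : Measurable (seqConsPair (S := S)) :=
    (measurable_seqCons.comp ((measurable_fst.comp measurable_fst).prodMk
      (measurable_fst.comp measurable_snd))).prodMk
    (measurable_seqCons.comp ((measurable_snd.comp measurable_fst).prodMk
      (measurable_snd.comp measurable_snd)))
  refine ⟨hm, ?_⟩
  conv_rhs => rw [markedSeqLaw]
  symm
  refine Measure.prod_eq fun s t hs ht => ?_
  set f : ℝ → (ℕ → ℝ) → ℝ≥0∞ := fun a x => s.indicator 1 (seqCons a x) with hf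
  set g : S → (ℕ → S) → ℝ≥0∞ := fun b y => t.indicator 1 (seqCons b y) with hg
  have hfm : Measurable fun q : ℝ × (ℕ → ℝ) => f q.1 q.2 :=
    (measurable_one.indicator hs).comp measurable_seqCons
  have hgm : Measurable fun q : S × (ℕ → S) => g q.1 q.2 :=
    (measurable_one.indicator ht).comp measurable_seqCons
  have hs' : Measure.infinitePi (fun _ : ℕ => τ) s =
      ∫⁻ a, ∫⁻ x, f a x ∂Measure.infinitePi (fun _ : ℕ => τ) ∂τ := by
    rw [← lintegral_prod _ hfm.aemeasurable,
      ← lintegral_map (f := s.indicator 1) (measurable_one.indicator hs) measurable_seqCons,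
      map_seqCons, lintegral_indicator_one hs]
  have ht' : Measure.infinitePi (fun _ : ℕ => ρ) t =
      ∫⁻ b, ∫⁻ y, g b y ∂Measure.infinitePi (fun _ : ℕ => ρ) ∂ρ := by
    rw [← lintegral_prod _ hgm.aemeasurable,
      ← lintegral_map (f := t.indicator 1) (measurable_one.indicator ht) measurable_seqCons,
      map_seqCons, lintegral_indicator_one ht]
  have hind (q : (ℝ × S) × ((ℕ → ℝ) × (ℕ → S))) :
      (s ×ˢ t).indicator 1 (seqConsPair q) = f q.1.1 q.2.1 * g q.1.2 q.2.2 := by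
    by_cases h1 : seqCons q.1.1 q.2.1 ∈ s <;> by_cases h2 : seqCons q.1.2 q.2.2 ∈ t <;>
      simp [hf, hg, seqConsPair, Set.indicator, h1, h2]
  rw [← lintegral_indicator_one (hs.prod ht),
    lintegral_map (measurable_one.indicator (hs.prod ht)) hm]
  simp_rw [hind]
  have hfm' : Measurable fun q : (ℝ × S) × ((ℕ → ℝ) × (ℕ → S)) => f q.1.1 q.2.1 :=
    hfm.comp ((measurable_fst.comp measurable_fst).prodMk (measurable_fst.comp measurable_snd))
  have hgm' : Measurable fun q : (ℝ × S) × ((ℕ → ℝ) × (ℕ → S)) => g q.1.2 q.2.2 :=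
    hgm.comp ((measurable_snd.comp measurable_fst).prodMk (measurable_snd.comp measurable_snd))
  rw [lintegral_prod _ (Measurable.aemeasurable (by exact hfm'.mul hgm')), hs', ht',
    ← lintegral_prod_mul hfm.lintegral_prod_right'.aemeasurable
      hgm.lintegral_prod_right'.aemeasurable]
  refine lintegral_congr fun ab => ?_
  rw [markedSeqLaw]
  exact lintegral_prod_mul (μ := Measure.infinitePi fun _ : ℕ => τ)
    (ν := Measure.infinitePi fun _ : ℕ => ρ) (f := f ab.1) (g := g ab.2)
    (hfm.comp measurable_prodMk_left).aemeasurable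
    (hgm.comp measurable_prodMk_left).aemeasurable

theorem IsMarkedPoissonClock.map_eq_markedSeqLaw {Ω S : Type*} [MeasurableSpace Ω]
    [MeasurableSpace S] {P : Measure Ω} [IsProbabilityMeasure P] {rate : ℝ} {ρ : Measure S}
    {T : ℕ → Ω → ℝ} {Y : ℕ → Ω → S} [IsProbabilityMeasure (expMeasure rate)]
    [IsProbabilityMeasure ρ] (h : IsMarkedPoissonClock P rate ρ T Y) :
    P.map (fun ω => (fun j => T j ω, fun j => Y j ω)) = markedSeqLaw (expMeasure rate) ρ := by
  rw [(indepFun_iff_map_prod_eq_prod_map_map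
    (measurable_pi_lambda _ h.clock.measurable).aemeasurable
    (measurable_pi_lambda _ h.measurable).aemeasurable).mp h.indep_clock,
    h.clock.indep.map_fun_eq_infinitePi_map h.clock.measurable,
    h.indep.map_fun_eq_infinitePi_map h.measurable, markedSeqLaw]
  simp only [h.clock.law, h.law]

theorem IsMarkedPoissonClock.comp {Ω S S' : Type*} [MeasurableSpace Ω]
    [MeasurableSpace S] [MeasurableSpace S'] {P : Measure Ω} {rate : ℝ} {ρ : Measure S}
    {T : ℕ → Ω → ℝ} {Y : ℕ → Ω → S} (h : IsMarkedPoissonClock P rate ρ T Y) {g : S → S'}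
    (hg : Measurable g) :
    IsMarkedPoissonClock P rate (ρ.map g) T (fun j ω => g (Y j ω)) where
  clock := h.clock
  measurable j := hg.comp (h.measurable j)
  indep := h.indep.comp (fun _ => g) (fun _ => hg)
  law j := by
    rw [← h.law j, Measure.map_map hg (h.measurable j)]
    rfl
  indep_clock := h.indep_clock.comp (φ := id) (ψ := fun (y : ℕ → S) (j : ℕ) => g (y j))
    measurable_id
    (measurable_pi_lambda _ fun j => hg.comp (measurable_pi_apply j))

theorem IsMarkedPoissonClock.isProbabilityMeasure {Ω S : Type*} [MeasurableSpace Ω]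
    [MeasurableSpace S] {P : Measure Ω} [IsProbabilityMeasure P] {rate : ℝ} {ρ : Measure S}
    {T : ℕ → Ω → ℝ} {Y : ℕ → Ω → S} (h : IsMarkedPoissonClock P rate ρ T Y) :
    IsProbabilityMeasure ρ := by
  rw [← h.law 0]
  exact Measure.isProbabilityMeasure_map (h.measurable 0).aemeasurable

theorem ae_forall_infinitePi {α : Type*} [MeasurableSpace α] {μ : Measure α}
    [IsProbabilityMeasure μ] {p : α → Prop} (h : ∀ᵐ a ∂μ, p a) :
    ∀ᵐ x ∂Measure.infinitePi fun _ : ℕ => μ, ∀ i, p (x i) :=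
  ae_all_iff.mpr fun i =>
    (measurePreserving_eval_infinitePi (fun _ : ℕ => μ) i).quasiMeasurePreserving.ae h

/-! ### Exponential waiting times and Beta integrals. -/

theorem expMeasure_real_Ioi {rate : ℝ} (hrate : 0 < rate) {t : ℝ} (ht : 0 ≤ t) :
    (expMeasure rate).real (Set.Ioi t) = Real.exp (-(rate * t)) := by
  have := isProbabilityMeasure_expMeasure hrate
  have h := cdf_expMeasure_eq hrate t
  rw [cdf_eq_real, if_pos ht] at h
  rw [← Set.compl_Iic, measureReal_compl measurableSet_Iic, h]
  simp

theorem ae_nonneg_expMeasure (rate : ℝ) : ∀ᵐ x ∂expMeasure rate, 0 ≤ x := by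
  have h : expMeasure rate (Set.Iio 0) = 0 := by
    rw [expMeasure, gammaMeasure, withDensity_apply _ measurableSet_Iio]
    exact lintegral_gammaPDF_of_nonpos le_rfl
  rw [ae_iff]
  simpa [Set.Iio] using h

/-- The waiting times of a Poisson process do not accumulate. -/
theorem ae_exists_lt_sum_expMeasure {rate : ℝ} (hrate : 0 < rate)
    [IsProbabilityMeasure (expMeasure rate)] {t : ℝ} (ht : 0 ≤ t) :
    ∀ᵐ x ∂Measure.infinitePi fun _ : ℕ => expMeasure rate,
      ∃ n, t < ∑ i ∈ Finset.range n, x i := by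
  have hq : expMeasure rate (Set.Iic t) < 1 := by
    have h := expMeasure_real_Ioi hrate ht
    have h1 : (expMeasure rate).real (Set.Iic t) < 1 := by
      have h2 := measureReal_compl (μ := expMeasure rate) (measurableSet_Ioi (a := t))
      rw [Set.compl_Ioi, h] at h2
      simp only [probReal_univ] at h2
      rw [h2]
      linarith [Real.exp_pos (-(rate * t))]
    rw [← ENNReal.toReal_lt_toReal (measure_ne_top _ _) ENNReal.one_ne_top]
    simpa [Measure.real] using h1
  -- Waiting times being nonnegative, one of them exceeding `t` is enough. The first `n` all stay
  -- below `t` with probability `q^n`, where `q < 1`.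
  have hle (n : ℕ) : (Measure.infinitePi fun _ : ℕ => expMeasure rate)
      {x : ℕ → ℝ | ∀ i, x i ∈ Set.Iic t} ≤ expMeasure rate (Set.Iic t) ^ n := by
    refine (measure_mono (t := (Finset.range n : Set ℕ).pi fun _ => Set.Iic t)
      fun x (hx : ∀ i, x i ∈ Set.Iic t) i _ => hx i).trans ?_
    rw [Measure.infinitePi_pi _ fun _ _ => measurableSet_Iic]
    simp
  have h0 : (Measure.infinitePi fun _ : ℕ => expMeasure rate)
      {x : ℕ → ℝ | ∀ i, x i ∈ Set.Iic t} = 0 :=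
    le_antisymm (ge_of_tendsto' (ENNReal.tendsto_pow_atTop_nhds_zero_of_lt_one hq) hle)
      zero_le
  have h0' : ∀ᵐ x ∂Measure.infinitePi fun _ : ℕ => expMeasure rate, ¬∀ i, x i ∈ Set.Iic t := by
    rw [ae_iff]; simpa using h0
  filter_upwards [h0', ae_forall_infinitePi (ae_nonneg_expMeasure rate)] with x hx hx0
  simp only [Set.mem_Iic, not_forall, not_le] at hx
  obtain ⟨i, hi⟩ := hx
  exact ⟨i + 1, hi.trans_le (Finset.single_le_sum (f := x) (fun j _ => hx0 j)
    (Finset.self_mem_range_succ i))⟩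

theorem integral_expMeasure {rate : ℝ} (hrate : 0 < rate) (g : ℝ → ℝ) :
    ∫ a, g a ∂expMeasure rate =
      ∫ a in Set.Ici (0 : ℝ), rate * Real.exp (-(rate * a)) * g a := by
  have h : expMeasure rate = volume.withDensity (exponentialPDF rate) := rfl
  have hm : Measurable (exponentialPDF rate) :=
    (measurable_exponentialPDFReal rate).ennreal_ofReal
  rw [h, integral_withDensity_eq_integral_toReal_smul hm
    (ae_of_all _ fun _ => ENNReal.ofReal_lt_top), ← integral_indicator measurableSet_Ici]
  refine integral_congr_ae (ae_of_all _ fun a => ?_)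
  by_cases ha : 0 ≤ a
  · have hp : 0 ≤ rate * Real.exp (-(rate * a)) := by positivity
    simp only [exponentialPDF_of_nonneg ha, ENNReal.toReal_ofReal hp, smul_eq_mul]
    rw [Set.indicator_of_mem (Set.mem_Ici.mpr ha)]
  · simp only [exponentialPDF_of_neg (not_le.mp ha), ENNReal.toReal_zero, zero_smul]
    rw [Set.indicator_of_notMem (s := Set.Ici (0 : ℝ)) fun h => ha h]

theorem integral_pow_mul_sub_pow (i m : ℕ) (t : ℝ) :
    ∫ a in (0 : ℝ)..t, a ^ i * (t - a) ^ m =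
      (i.factorial * m.factorial / (i + m + 1).factorial : ℝ) * t ^ (i + m + 1) := by
  induction m generalizing i with
  | zero =>
    simp only [pow_zero, mul_one, add_zero, Nat.factorial_zero, Nat.cast_one, integral_pow,
      Nat.factorial_succ]
    push_cast
    have : (i.factorial : ℝ) ≠ 0 := by positivity
    field_simp
    simp
  | succ m ih =>
    have hi1 : IntervalIntegrable (fun a : ℝ => ((i : ℝ) + 1) * (a ^ i * (t - a) ^ (m + 1)))
        volume 0 t := by apply Continuous.intervalIntegrable; fun_prop
    have hi2 : IntervalIntegrable (fun a : ℝ => ((m : ℝ) + 1) * (a ^ (i + 1) * (t - a) ^ m))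
        volume 0 t := by apply Continuous.intervalIntegrable; fun_prop
    have h := intervalIntegral.integral_eq_sub_of_hasDerivAt (a := 0) (b := t)
      (f := fun a : ℝ => a ^ (i + 1) * (t - a) ^ (m + 1))
      (f' := fun a : ℝ => ((i : ℝ) + 1) * (a ^ i * (t - a) ^ (m + 1)) -
        ((m : ℝ) + 1) * (a ^ (i + 1) * (t - a) ^ m))
      (fun a _ => ((hasDerivAt_pow (i + 1) a).fun_mul
        (((hasDerivAt_id a).const_sub t).fun_pow (m + 1))).congr_deriv
        (by simp only [id, Nat.add_sub_cancel]; push_cast; ring)) (hi1.sub hi2)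
    rw [intervalIntegral.integral_sub hi1 hi2, intervalIntegral.integral_const_mul,
      intervalIntegral.integral_const_mul, ih] at h
    simp only [sub_self, ne_eq, Nat.add_eq_zero_iff, one_ne_zero, and_false, not_false_eq_true,
      zero_pow, mul_zero, zero_mul] at h
    have hne : (i : ℝ) + 1 ≠ 0 := by positivity
    refine mul_left_cancel₀ hne ?_
    rw [sub_eq_zero.mp h, show i + (m + 1) + 1 = i + 1 + m + 1 by ring,
      Nat.factorial_succ i, Nat.factorial_succ m]
    push_cast
    ring

theorem integral_comp_of_measurePreserving {α β : Type*} [MeasurableSpace α] [MeasurableSpace β]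
    {μ : Measure α} {ν : Measure β} {f : α → β} (hf : MeasurePreserving f μ ν) {g : β → ℝ}
    (hg : Measurable g) : ∫ x, g (f x) ∂μ = ∫ y, g y ∂ν := by
  rw [← hf.map_eq, integral_map hf.measurable.aemeasurable hg.aestronglyMeasurable]

/-! ### Moments of the position with a given number of events. -/

/-- The sequences of waiting times with exactly `n` events in `[0, t]`. -/
def countSet (n : ℕ) (t : ℝ) : Set (ℕ → ℝ) :=
  {x | ∑ i ∈ Finset.range n, x i ≤ t ∧ t < ∑ i ∈ Finset.range (n + 1), x i}

/-- The position at time `t` of a unit speed motion which has been through `n` events. -/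
def legSum (n : ℕ) (t : ℝ) (p : (ℕ → ℝ) × (ℕ → ℝ)) : ℝ :=
  ∑ j ∈ Finset.range n, p.1 j * p.2 j + (t - ∑ j ∈ Finset.range n, p.1 j) * p.2 n

theorem measurableSet_countSet (n : ℕ) (t : ℝ) : MeasurableSet (countSet n t) := by
  have hm (m : ℕ) : Measurable fun x : ℕ → ℝ => ∑ i ∈ Finset.range m, x i := by fun_prop
  exact (measurableSet_le (hm n) measurable_const).inter
    (measurableSet_lt measurable_const (hm (n + 1)))

theorem measurable_legSum (n : ℕ) (t : ℝ) : Measurable (legSum n t) := by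
  unfold legSum
  fun_prop

theorem seqCons_mem_countSet (n : ℕ) (t a : ℝ) (x : ℕ → ℝ) :
    seqCons a x ∈ countSet (n + 1) t ↔ x ∈ countSet n (t - a) := by
  have h (m : ℕ) : ∑ i ∈ Finset.range (m + 1), seqCons a x i =
      ∑ i ∈ Finset.range m, x i + a := Finset.sum_range_succ' _ m
  simp only [countSet, Set.mem_ofPred_eq, h]
  constructor <;> rintro ⟨h1, h2⟩ <;> constructor <;> linarith

theorem legSum_seqCons (n : ℕ) (t a b : ℝ) (x y : ℕ → ℝ) :
    legSum (n + 1) t (seqCons a x, seqCons b y) = a * b + legSum n (t - a) (x, y) := by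
  simp only [legSum, Finset.sum_range_succ' _ n, seqCons]
  ring

theorem abs_legSum_le {n : ℕ} {t : ℝ} {p : (ℕ → ℝ) × (ℕ → ℝ)} (hx : ∀ i, 0 ≤ p.1 i)
    (hy : ∀ i, |p.2 i| ≤ 1) (hp : p.1 ∈ countSet n t) : |legSum n t p| ≤ t := by
  have h0 : 0 ≤ t - ∑ j ∈ Finset.range n, p.1 j := sub_nonneg.mpr hp.1
  calc
    |legSum n t p| ≤ ∑ j ∈ Finset.range n, |p.1 j * p.2 j| +
        |(t - ∑ j ∈ Finset.range n, p.1 j) * p.2 n| :=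
      (abs_add_le _ _).trans (add_le_add_left (Finset.abs_sum_le_sum_abs _ _) _)
    _ ≤ ∑ j ∈ Finset.range n, p.1 j + (t - ∑ j ∈ Finset.range n, p.1 j) := by
      refine add_le_add (Finset.sum_le_sum fun j _ => ?_) ?_
      · rw [abs_mul, abs_of_nonneg (hx j)]
        exact mul_le_of_le_one_right (hx j) (hy j)
      · rw [abs_mul, abs_of_nonneg h0]
        exact mul_le_of_le_one_right h0 (hy n)
    _ = t := by ring

/-- The `k`-th power of the position on the event of `n` changes of direction. -/
def legPow (n k : ℕ) (t : ℝ) (p : (ℕ → ℝ) × (ℕ → ℝ)) : ℝ :=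
  (Prod.fst ⁻¹' countSet n t).indicator (fun p => legSum n t p ^ k) p

theorem measurable_legPow (n k : ℕ) (t : ℝ) : Measurable (legPow n k t) :=
  ((measurable_legSum n t).pow_const k).indicator
    (measurable_fst (measurableSet_countSet n t))

section Moments

variable {rate : ℝ} [IsProbabilityMeasure (expMeasure rate)] {ρ : Measure ℝ}
  [IsProbabilityMeasure ρ]

theorem ae_markedSeqLaw (hρ : ∀ᵐ x ∂ρ, |x| ≤ 1) :
    ∀ᵐ p ∂markedSeqLaw (expMeasure rate) ρ, (∀ i, 0 ≤ p.1 i) ∧ ∀ i, |p.2 i| ≤ 1 := by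
  have h1 : ∀ᵐ p ∂markedSeqLaw (expMeasure rate) ρ, ∀ i, 0 ≤ p.1 i :=
    Measure.quasiMeasurePreserving_fst.ae (ae_forall_infinitePi (ae_nonneg_expMeasure rate))
  have h2 : ∀ᵐ p ∂markedSeqLaw (expMeasure rate) ρ, ∀ i, |p.2 i| ≤ 1 :=
    Measure.quasiMeasurePreserving_snd.ae (ae_forall_infinitePi hρ)
  filter_upwards [h1, h2] with p hp1 hp2 using ⟨hp1, hp2⟩

theorem integrable_legPow (hρ : ∀ᵐ x ∂ρ, |x| ≤ 1) (n k : ℕ) (t : ℝ) :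
    Integrable (legPow n k t) (markedSeqLaw (expMeasure rate) ρ) := by
  refine Integrable.of_bound (measurable_legPow n k t).aestronglyMeasurable (|t| ^ k) ?_
  filter_upwards [ae_markedSeqLaw hρ] with p hp
  by_cases h : p.1 ∈ countSet n t
  · rw [legPow, Set.indicator_of_mem (by exact h), Real.norm_eq_abs, abs_pow]
    exact pow_le_pow_left₀ (abs_nonneg _)
      ((abs_legSum_le hp.1 hp.2 h).trans (le_abs_self t)) k
  · rw [legPow, Set.indicator_of_notMem (by exact h), norm_zero]
    positivity

/-- Binomial expansion of the first displacement plus the displacement of the restarted motion,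
which has time `t - a` left and one event fewer. -/
theorem legPow_seqConsPair (n k : ℕ) (t : ℝ) (q : (ℝ × ℝ) × ((ℕ → ℝ) × (ℕ → ℝ))) :
    legPow (n + 1) k t (seqConsPair q) = ∑ ij ∈ Finset.HasAntidiagonal.antidiagonal k,
      (k.choose ij.1 * (q.1.1 * q.1.2) ^ ij.1) * legPow n ij.2 (t - q.1.1) q.2 := by
  obtain ⟨⟨a, b⟩, x, y⟩ := q
  simp only [legPow, seqConsPair]
  by_cases h : x ∈ countSet n (t - a)
  · rw [Set.indicator_of_mem (by exact (seqCons_mem_countSet n t a x).mpr h), legSum_seqCons,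
      (Commute.all (a * b) (legSum n (t - a) (x, y))).add_pow']
    refine Finset.sum_congr rfl fun ij _ => ?_
    rw [Set.indicator_of_mem (by exact h), nsmul_eq_mul]
    ring
  · rw [Set.indicator_of_notMem (by exact fun h' => h ((seqCons_mem_countSet n t a x).mp h'))]
    symm
    refine Finset.sum_eq_zero fun ij _ => ?_
    rw [Set.indicator_of_notMem (by exact h), mul_zero]

theorem integral_legPow_zero (hrate : 0 < rate) (k : ℕ) (t : ℝ) :
    ∫ p, legPow 0 k t p ∂markedSeqLaw (expMeasure rate) ρ =
      if 0 ≤ t then Real.exp (-(rate * t)) * t ^ k * ∫ y, y ^ k ∂ρ else 0 := by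
  have e (p : (ℕ → ℝ) × (ℕ → ℝ)) : legPow 0 k t p =
      (countSet 0 t).indicator (fun _ => t ^ k) p.1 * p.2 0 ^ k := by
    by_cases h : p.1 ∈ countSet 0 t
    · rw [legPow, Set.indicator_of_mem (by exact h), Set.indicator_of_mem h, legSum]
      simp [mul_pow]
    · rw [legPow, Set.indicator_of_notMem (by exact h), Set.indicator_of_notMem h, zero_mul]
  simp_rw [e]
  rw [markedSeqLaw, integral_prod_mul (fun x => (countSet 0 t).indicator (fun _ => t ^ k) x)
      fun y : ℕ → ℝ => y 0 ^ k,
    integral_indicator_const _ (measurableSet_countSet 0 t),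
    integral_comp_of_measurePreserving (measurePreserving_eval_infinitePi (fun _ : ℕ => ρ) 0)
      (g := fun y => y ^ k) (by fun_prop)]
  split_ifs with ht
  · have hs : countSet 0 t = Function.eval 0 ⁻¹' Set.Ioi t := by
      ext x; simp [countSet, ht]
    rw [hs, (measurePreserving_eval_infinitePi (fun _ : ℕ => expMeasure rate) 0).measureReal_preimage
      measurableSet_Ioi.nullMeasurableSet, expMeasure_real_Ioi hrate ht, smul_eq_mul]
  · have hs : countSet 0 t = ∅ := by
      ext x; simp [countSet, ht]
    simp [hs]

/-- The two exponentials combine to `exp(-λt)`, free of `a`, and leave a Beta integral over `[0,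
t]`. -/
theorem integral_expMeasure_pow_mul (hrate : 0 < rate) (i m : ℕ) (t K : ℝ) :
    Integrable (fun a => a ^ i *
      if 0 ≤ t - a then Real.exp (-(rate * (t - a))) * (t - a) ^ m * K else 0)
        (expMeasure rate) ∧
    ∫ a, a ^ i * (if 0 ≤ t - a then Real.exp (-(rate * (t - a))) * (t - a) ^ m * K else 0)
        ∂expMeasure rate =
      if 0 ≤ t then rate * Real.exp (-(rate * t)) *
        ((i.factorial * m.factorial / (i + m + 1).factorial : ℝ) * t ^ (i + m + 1)) * K
      else 0 := by
  constructor
  · refine Integrable.of_bound (Measurable.aestronglyMeasurable ?_) (|t| ^ i * (|t| ^ m * |K|)) ?_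
    · refine (measurable_id.pow_const i).mul (Measurable.ite ?_ (by fun_prop) measurable_const)
      exact measurableSet_le measurable_const (by fun_prop)
    · filter_upwards [ae_nonneg_expMeasure rate] with a ha
      split_ifs with h
      · have hat : |a| ≤ |t| := by
          rw [abs_of_nonneg ha, abs_of_nonneg (by linarith)]; linarith
        have hta : |t - a| ≤ |t| := by
          rw [abs_of_nonneg h, abs_of_nonneg (by linarith)]; linarith
        have hexp : |Real.exp (-(rate * (t - a)))| ≤ 1 := by
          rw [abs_of_pos (Real.exp_pos _), Real.exp_le_one_iff]
          have := mul_nonneg hrate.le h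
          linarith
        rw [Real.norm_eq_abs, abs_mul, abs_mul, abs_mul, abs_pow, abs_pow]
        gcongr
        calc |Real.exp (-(rate * (t - a)))| * |t - a| ^ m ≤ 1 * |t| ^ m := by gcongr
          _ = |t| ^ m := one_mul _
      · rw [mul_zero, norm_zero]
        positivity
  · rw [integral_expMeasure hrate]
    split_ifs with ht
    · rw [← integral_pow_mul_sub_pow, intervalIntegral.integral_of_le ht,
        ← integral_Icc_eq_integral_Ioc, ← integral_const_mul, ← integral_mul_const,
        ← integral_indicator measurableSet_Ici, ← integral_indicator measurableSet_Icc]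
      refine integral_congr_ae (ae_of_all _ fun a => ?_)
      simp only [Set.indicator, Set.mem_Ici, Set.mem_Icc]
      by_cases h0 : 0 ≤ a
      · by_cases h1 : a ≤ t
        · have h2 : 0 ≤ t - a := sub_nonneg.mpr h1
          have e : Real.exp (-(rate * t)) =
              Real.exp (-(rate * a)) * Real.exp (-(rate * (t - a))) := by
            rw [← Real.exp_add]; congr 1; ring
          simp only [h0, h1, h2, and_self, if_true, e]
          ring
        · have h2 : ¬0 ≤ t - a := fun h => h1 (sub_nonneg.mp h)
          simp [h1, h2]
      · simp [h0]
    · refine setIntegral_eq_zero_of_forall_eq_zero fun a ha => ?_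
      have ha : 0 ≤ a := ha
      have h2 : ¬0 ≤ t - a := by linarith
      simp [h2]

/-- The unnormalized conditional moments of the position given the number of events. -/
theorem integral_legPow (hrate : 0 < rate) (hρ : ∀ᵐ x ∂ρ, |x| ≤ 1) (n k : ℕ) (t : ℝ) :
    ∫ p, legPow n k t p ∂markedSeqLaw (expMeasure rate) ρ =
      if 0 ≤ t then Real.exp (-(rate * t)) * t ^ (n + k) * (rate ^ n *
        (k.factorial / (n + k).factorial) *
          PowerSeries.coeff k ((PowerSeries.mk fun i => ∫ y, y ^ i ∂ρ) ^ (n + 1)))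
      else 0 := by
  set B : PowerSeries ℝ := PowerSeries.mk fun i => ∫ y, y ^ i ∂ρ with hB
  -- Negative times have to be included, since the first waiting time may exceed `t`.
  induction n generalizing k t with
  | zero =>
    rw [integral_legPow_zero hrate]
    have : (k.factorial : ℝ) ≠ 0 := by positivity
    simp [hB, this]
  | succ n ih =>
    have hΦ := measurePreserving_seqConsPair (expMeasure rate) ρ
    have hint : Integrable (fun q => legPow (n + 1) k t (seqConsPair q))
        (((expMeasure rate).prod ρ).prod (markedSeqLaw (expMeasure rate) ρ)) :=
      hΦ.integrable_comp_of_integrable (integrable_legPow hρ (n + 1) k t)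
    rw [← integral_comp_of_measurePreserving hΦ (measurable_legPow (n + 1) k t),
      integral_prod _ hint]
    simp_rw [legPow_seqConsPair]
    have hin (ab : ℝ × ℝ) : ∫ p, ∑ ij ∈ Finset.HasAntidiagonal.antidiagonal k,
        (k.choose ij.1 * (ab.1 * ab.2) ^ ij.1) * legPow n ij.2 (t - ab.1) p
          ∂markedSeqLaw (expMeasure rate) ρ = ∑ ij ∈ Finset.HasAntidiagonal.antidiagonal k, (ab.1 ^ ij.1 *
        if 0 ≤ t - ab.1 then Real.exp (-(rate * (t - ab.1))) * (t - ab.1) ^ (n + ij.2) *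
          (k.choose ij.1 * (rate ^ n * (ij.2.factorial / (n + ij.2).factorial) *
            PowerSeries.coeff ij.2 (B ^ (n + 1)))) else 0) * ab.2 ^ ij.1 := by
      rw [integral_finsetSum _ fun ij _ => (integrable_legPow hρ n ij.2 _).const_mul _]
      refine Finset.sum_congr rfl fun ij _ => ?_
      rw [integral_const_mul, ih]
      split_ifs
      · rw [mul_pow]; ring
      · simp
    simp_rw [hin]
    rw [integral_finsetSum _ fun ij _ => Integrable.mul_prod
      (integral_expMeasure_pow_mul hrate ij.1 (n + ij.2) t _).1
      (integrable_pow_of_ae_abs_le hρ ij.1)]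
    -- The factor `C(k,i) · j!/(n+j)! · i!(n+j)!/(n+1+k)!` collapses to `k!/(n+1+k)!`, whatever the
    -- splitting `i + j = k`. What remains is the Cauchy product of `B` and `B^(n+1)`.
    have hsum (ij : ℕ × ℕ) (hij : ij ∈ Finset.HasAntidiagonal.antidiagonal k) :
        ∫ ab : ℝ × ℝ, (ab.1 ^ ij.1 *
        if 0 ≤ t - ab.1 then Real.exp (-(rate * (t - ab.1))) * (t - ab.1) ^ (n + ij.2) *
          (k.choose ij.1 * (rate ^ n * (ij.2.factorial / (n + ij.2).factorial) *
            PowerSeries.coeff ij.2 (B ^ (n + 1)))) else 0) * ab.2 ^ ij.1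
          ∂(expMeasure rate).prod ρ =
        (if 0 ≤ t then Real.exp (-(rate * t)) * t ^ (n + 1 + k) * (rate ^ (n + 1) *
          (k.factorial / (n + 1 + k).factorial)) else 0) *
        (PowerSeries.coeff ij.1 B * PowerSeries.coeff ij.2 (B ^ (n + 1))) := by
      obtain ⟨i, j⟩ := ij
      have hk : i + j = k := by simpa using hij
      subst hk
      simp only
      rw [integral_prod_mul (fun a : ℝ => a ^ i *
        if 0 ≤ t - a then Real.exp (-(rate * (t - a))) * (t - a) ^ (n + j) *
          ((i + j).choose i * (rate ^ n * (j.factorial / (n + j).factorial) *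
            PowerSeries.coeff j (B ^ (n + 1)))) else 0) (fun b : ℝ => b ^ i),
        (integral_expMeasure_pow_mul hrate i (n + j) t _).2, hB, PowerSeries.coeff_mk, ← hB,
        show i + (n + j) + 1 = n + 1 + (i + j) by ring]
      split_ifs
      · have hc : ((i + j).choose i : ℝ) * i.factorial * j.factorial = (i + j).factorial := by
          have := Nat.add_choose_mul_factorial_mul_factorial j i
          rw [add_comm j i] at this
          rw [mul_right_comm]
          exact_mod_cast this
        have h1 : ((n + 1 + (i + j)).factorial : ℝ) ≠ 0 := by positivity
        have h2 : ((n + j).factorial : ℝ) ≠ 0 := by positivity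
        rw [← hc]
        field_simp
        ring
      · simp
    rw [Finset.sum_congr rfl hsum, ← Finset.mul_sum, pow_succ' B (n + 1), PowerSeries.coeff_mul]
    split_ifs
    · ring
    · simp

end Moments

/-! ### Path by path description and measurability. -/

section Paths

variable {Ω : Type*} {T : ℕ → Ω → ℝ}

theorem arrivalTime_mono {ω : Ω} (h0 : ∀ i, 0 ≤ T i ω) {m n : ℕ} (hmn : m ≤ n) :
    arrivalTime T m ω ≤ arrivalTime T n ω :=
  Finset.sum_le_sum_of_subset_of_nonneg (Finset.range_subset_range.mpr hmn) fun i _ _ => h0 i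

theorem eventCount_eq_of_mem {ω : Ω} (h0 : ∀ i, 0 ≤ T i ω) {t : ℝ} {n : ℕ}
    (h : (fun j => T j ω) ∈ countSet n t) : eventCount T t ω = n := by
  have e : {j : ℕ | arrivalTime T (j + 1) ω ≤ t} = (Finset.range n : Set ℕ) := by
    ext j
    simp only [Set.mem_ofPred_eq, Finset.coe_range, Set.mem_Iio]
    constructor
    · intro hj
      by_contra hn
      exact absurd (hj.trans_lt h.2)
        (not_lt.mpr (arrivalTime_mono h0 (Nat.succ_le_succ (not_lt.mp hn))))
    · exact fun hj => (arrivalTime_mono h0 (Nat.succ_le_of_lt hj)).trans h.1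
  rw [eventCount, e, Set.ncard_coe_finset, Finset.card_range]

theorem exists_mem_countSet {ω : Ω} {t : ℝ} (ht : 0 ≤ t)
    (hex : ∃ n, t < ∑ i ∈ Finset.range n, T i ω) :
    ∃ n, (fun j => T j ω) ∈ countSet n t := by
  classical
  have hmin := @Nat.find_min _ _ hex
  have hspec := Nat.find_spec hex
  cases hm : Nat.find hex with
  | zero =>
    rw [hm] at hspec
    simp only [Finset.range_zero, Finset.sum_empty] at hspec
    exact absurd hspec (not_lt.mpr ht)
  | succ m =>
    rw [hm] at hspec
    exact ⟨m, not_lt.mp (hmin (by omega)), hspec⟩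

/-- Non-accumulation matters: `Set.ncard` of an infinite set is `0`, so infinitely many events
before `t` would be counted as none. -/
theorem eventCount_eq_iff {ω : Ω} (h0 : ∀ i, 0 ≤ T i ω) {t : ℝ} (ht : 0 ≤ t)
    (hex : ∃ n, t < ∑ i ∈ Finset.range n, T i ω) (n : ℕ) :
    eventCount T t ω = n ↔ (fun j => T j ω) ∈ countSet n t := by
  refine ⟨fun h => ?_, eventCount_eq_of_mem h0⟩
  obtain ⟨m, hm⟩ := exists_mem_countSet ht hex
  rwa [← h, eventCount_eq_of_mem h0 hm]

theorem randomMotion_of_eventCount_eq {E : Type*} [AddCommGroup E] [Module ℝ E] (c : ℝ)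
    (u : ℕ → Ω → E) {t : ℝ} {ω : Ω} {n : ℕ} (h : eventCount T t ω = n) :
    randomMotion c T u t ω = c • (∑ j ∈ Finset.range n, T j ω • u j ω +
      (t - arrivalTime T n ω) • u n ω) := by
  rw [randomMotion, h, Finset.sum_range_succ]
  congr 2
  · refine Finset.sum_congr rfl fun j hj => ?_
    have hj := Finset.mem_range.mp hj
    rw [epoch, epoch, h, if_pos (Nat.succ_le_of_lt hj), if_pos hj.le, arrivalTime, arrivalTime,
      Finset.sum_range_succ, add_sub_cancel_left]
  · rw [epoch, epoch, h, if_neg (by omega), if_pos le_rfl]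

theorem measurable_eventCount [MeasurableSpace Ω] (hT : ∀ j, Measurable (T j)) (t : ℝ) :
    Measurable (eventCount T t) := by
  have hA (j : ℕ) : Measurable (arrivalTime T j) :=
    Finset.measurable_fun_sum _ fun i _ => hT i
  have hF (F : Finset ℕ) :
      MeasurableSet {ω | {j : ℕ | arrivalTime T (j + 1) ω ≤ t} = (F : Set ℕ)} := by
    have e : {ω | {j : ℕ | arrivalTime T (j + 1) ω ≤ t} = (F : Set ℕ)} =
        ⋂ j, {ω | arrivalTime T (j + 1) ω ≤ t ↔ j ∈ F} := by
      ext ω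
      simp [Set.ext_iff]
    rw [e]
    refine MeasurableSet.iInter fun j => ?_
    by_cases hj : j ∈ F
    · simpa [hj] using measurableSet_le (hA (j + 1)) measurable_const
    · simpa [hj] using measurableSet_lt measurable_const (hA (j + 1))
  have hpos (n : ℕ) (hn : n ≠ 0) : MeasurableSet {ω | eventCount T t ω = n} := by
    have e : {ω | eventCount T t ω = n} = ⋃ F : {F : Finset ℕ // F.card = n},
        {ω | {j : ℕ | arrivalTime T (j + 1) ω ≤ t} = ((F : Finset ℕ) : Set ℕ)} := by
      ext ω
      simp only [Set.mem_ofPred_eq, Set.mem_iUnion]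
      constructor
      · intro h
        have hfin : {j : ℕ | arrivalTime T (j + 1) ω ≤ t}.Finite :=
          Set.finite_of_ncard_ne_zero (by rw [← h] at hn; exact hn)
        refine ⟨⟨hfin.toFinset, ?_⟩, by simp⟩
        rw [← h, eventCount, Set.ncard_eq_toFinset_card _ hfin]
      · rintro ⟨F, hF⟩
        rw [eventCount, hF, Set.ncard_coe_finset, F.2]
    rw [e]
    exact MeasurableSet.iUnion fun F => hF F
  refine measurable_to_countable' fun n => ?_
  by_cases hn : n = 0
  -- The value `0` also absorbs the infinite index sets, hence the passage to the complement of the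
  -- positive values.
  · have e : eventCount T t ⁻¹' {n} = (⋃ m : ℕ, {ω | eventCount T t ω = m + 1})ᶜ := by
      ext ω
      simp only [hn, Set.mem_preimage, Set.mem_singleton_iff, Set.mem_compl_iff, Set.mem_iUnion,
        Set.mem_ofPred_eq, not_exists]
      exact ⟨fun h m => by omega, fun h => by
        by_contra h0
        exact h (eventCount T t ω - 1) (by omega)⟩
    rw [e]
    exact (MeasurableSet.iUnion fun m => hpos (m + 1) m.succ_ne_zero).compl
  · exact hpos n hn

/-- For a fixed count the position is a finite measurable expression, and the count takes countably
many values. -/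
theorem measurable_randomMotion [MeasurableSpace Ω] {u : ℕ → Ω → ℝ}
    (hT : ∀ j, Measurable (T j)) (hu : ∀ j, Measurable (u j)) (c t : ℝ) :
    Measurable (randomMotion c T u t) := by
  have hA (j : ℕ) : Measurable (arrivalTime T j) :=
    Finset.measurable_fun_sum _ fun i _ => hT i
  have hG (n : ℕ) : Measurable fun ω => c • (∑ j ∈ Finset.range n, T j ω • u j ω +
      (t - arrivalTime T n ω) • u n ω) := by fun_prop
  have h := (measurable_from_prod_countable_right
    (f := fun q : ℕ × Ω => c • (∑ j ∈ Finset.range q.1, T j q.2 • u j q.2 +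
      (t - arrivalTime T q.1 q.2) • u q.1 q.2)) hG).comp
    ((measurable_eventCount hT t).prodMk measurable_id)
  refine (congrArg Measurable ?_).mpr h
  ext ω
  exact randomMotion_of_eventCount_eq c u rfl

end Paths

/-! ### Transfer to the canonical space and conditional laws. -/

/-- The coordinate waiting times on the space of pairs of sequences. -/
def coordTime {S : Type*} (j : ℕ) (p : (ℕ → ℝ) × (ℕ → S)) : ℝ := p.1 j

/-- The coordinate marks on the space of pairs of sequences. -/
def coordMark {S : Type*} (j : ℕ) (p : (ℕ → ℝ) × (ℕ → S)) : S := p.2 j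

theorem measurable_coordTime {S : Type*} [MeasurableSpace S] (j : ℕ) :
    Measurable (coordTime (S := S) j) :=
  (measurable_pi_apply j).comp measurable_fst

theorem measurable_coordMark {S : Type*} [MeasurableSpace S] (j : ℕ) :
    Measurable (coordMark (S := S) j) :=
  (measurable_pi_apply j).comp measurable_snd

theorem IsMarkedPoissonClock.measurable_pair {Ω S : Type*} [MeasurableSpace Ω]
    [MeasurableSpace S] {P : Measure Ω} {rate : ℝ} {ρ : Measure S} {T : ℕ → Ω → ℝ}
    {Y : ℕ → Ω → S} (h : IsMarkedPoissonClock P rate ρ T Y) :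
    Measurable fun ω => (fun j => T j ω, fun j => Y j ω) :=
  (measurable_pi_lambda _ h.clock.measurable).prodMk (measurable_pi_lambda _ h.measurable)

section Laws

variable {Ω : Type*} [MeasurableSpace Ω] {P : Measure Ω} [IsProbabilityMeasure P] {rate : ℝ}
  {ρ : Measure ℝ} {T Y : ℕ → Ω → ℝ} [IsProbabilityMeasure (expMeasure rate)]
  [IsProbabilityMeasure ρ]

/-- The conditional law given the number of events only depends on the law of the clock. -/
theorem IsMarkedPoissonClock.lawGivenCount_eq (h : IsMarkedPoissonClock P rate ρ T Y)
    (c t : ℝ) (n : ℕ) :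
    lawGivenCount P T t n (randomMotion c T Y t) =
      lawGivenCount (markedSeqLaw (expMeasure rate) ρ) coordTime t n
        (randomMotion c coordTime coordMark t) := by
  have hA : MeasurableSet {p : (ℕ → ℝ) × (ℕ → ℝ) | eventCount coordTime t p = n} :=
    measurable_eventCount measurable_coordTime t (measurableSet_singleton n)
  rw [lawGivenCount, lawGivenCount, ProbabilityTheory.cond, ProbabilityTheory.cond,
    ← h.map_eq_markedSeqLaw, Measure.map_apply h.measurable_pair hA,
    Measure.restrict_map h.measurable_pair hA, Measure.map_smul, Measure.map_smul,
    Measure.map_map (measurable_randomMotion measurable_coordTime measurable_coordMark c t)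
      h.measurable_pair]
  rfl

theorem IsMarkedPoissonClock.map_process (h : IsMarkedPoissonClock P rate ρ T Y) (c : ℝ) :
    P.map (fun ω (t : ℝ≥0) => randomMotion c T Y t ω) =
      (markedSeqLaw (expMeasure rate) ρ).map
        fun p (t : ℝ≥0) => randomMotion c coordTime coordMark t p := by
  rw [← h.map_eq_markedSeqLaw, Measure.map_map (measurable_pi_lambda _ fun t : ℝ≥0 =>
    measurable_randomMotion measurable_coordTime measurable_coordMark c t) h.measurable_pair]
  rfl

theorem ae_eventCount_eq_iff (hrate : 0 < rate) {t : ℝ} (ht : 0 ≤ t) (n : ℕ) :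
    ∀ᵐ p ∂markedSeqLaw (expMeasure rate) ρ,
      eventCount coordTime t p = n ↔ p.1 ∈ countSet n t := by
  have h1 : ∀ᵐ p ∂markedSeqLaw (expMeasure rate) ρ, ∀ i, 0 ≤ p.1 i :=
    Measure.quasiMeasurePreserving_fst.ae (ae_forall_infinitePi (ae_nonneg_expMeasure rate))
  have h2 : ∀ᵐ p ∂markedSeqLaw (expMeasure rate) ρ,
      ∃ n, t < ∑ i ∈ Finset.range n, p.1 i :=
    Measure.quasiMeasurePreserving_fst.ae (ae_exists_lt_sum_expMeasure hrate ht)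
  filter_upwards [h1, h2] with p hp1 hp2
  exact eventCount_eq_iff (T := coordTime) hp1 ht hp2 n

theorem setIntegral_randomMotion_pow (hrate : 0 < rate) {t : ℝ} (ht : 0 ≤ t) (c : ℝ) (n k : ℕ) :
    ∫ p in {p | eventCount coordTime t p = n}, randomMotion c coordTime coordMark t p ^ k
        ∂markedSeqLaw (expMeasure rate) ρ =
      c ^ k * ∫ p, legPow n k t p ∂markedSeqLaw (expMeasure rate) ρ := by
  have hA : MeasurableSet {p : (ℕ → ℝ) × (ℕ → ℝ) | eventCount coordTime t p = n} :=
    measurable_eventCount measurable_coordTime t (measurableSet_singleton n)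
  rw [← integral_indicator hA, ← integral_const_mul]
  refine integral_congr_ae ?_
  filter_upwards [ae_eventCount_eq_iff hrate ht n] with p hp
  by_cases h : eventCount coordTime t p = n
  · rw [Set.indicator_of_mem (by exact h), legPow, Set.indicator_of_mem (by exact hp.mp h),
      randomMotion_of_eventCount_eq c _ h, smul_eq_mul, mul_pow]
    rfl
  · rw [Set.indicator_of_notMem (by exact h), legPow,
      Set.indicator_of_notMem (by exact fun h' => h (hp.mpr h')), mul_zero]

theorem integral_legPow_zero_pos (hrate : 0 < rate) (hρ : ∀ᵐ x ∂ρ, |x| ≤ 1) {t : ℝ}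
    (ht : 0 < t) (n : ℕ) : 0 < ∫ p, legPow n 0 t p ∂markedSeqLaw (expMeasure rate) ρ := by
  rw [integral_legPow hrate hρ, if_pos ht.le,
    coeff_zero_pow_of_coeff_zero_eq_one (by simp), mul_one]
  positivity

/-- If the moment series of `ρ` has the right power, the conditional law of a motion with
direction law `ρ` given `n` events is a scaling of `σ`. -/
theorem IsMarkedPoissonClock.lawGivenCount_eq_map (h : IsMarkedPoissonClock P rate ρ T Y)
    (hrate : 0 < rate) (hρ : ∀ᵐ x ∂ρ, |x| ≤ 1) {c t : ℝ} (hc : 0 < c) (ht : 0 < t) (n : ℕ)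
    {σ : Measure ℝ} [IsProbabilityMeasure σ] (hσ : ∀ᵐ x ∂σ, |x| ≤ 1)
    (hmom : ∀ k, PowerSeries.coeff k ((PowerSeries.mk fun i => ∫ y, y ^ i ∂ρ) ^ (n + 1)) =
      (n + k).choose k * ∫ x, x ^ k ∂σ) :
    lawGivenCount P T t n (randomMotion c T Y t) = σ.map fun x => c * t * x := by
  rw [h.lawGivenCount_eq]
  set κ := markedSeqLaw (expMeasure rate) ρ with hκ
  set A := {p : (ℕ → ℝ) × (ℕ → ℝ) | eventCount coordTime t p = n} with hAdef
  have hA : MeasurableSet A :=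
    measurable_eventCount measurable_coordTime t (measurableSet_singleton n)
  have hm := measurable_randomMotion (measurable_coordTime (S := ℝ)) measurable_coordMark c t
  have hscale : Measurable fun x : ℝ => c * t * x := by fun_prop
  -- The zeroth moment is the probability of the conditioning event, so the same formula provides
  -- the normalization.
  have hκA : κ.real A = ∫ p, legPow n 0 t p ∂κ := by
    simpa [← hκ] using (setIntegral_randomMotion_pow (ρ := ρ) hrate ht.le c n 0)
  have hpos := integral_legPow_zero_pos hrate hρ ht n
  have hne : κ A ≠ 0 := by
    intro h0
    rw [← hκ, ← hκA, Measure.real, h0] at hpos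
    simp at hpos
  have := cond_isProbabilityMeasure hne
  have : IsProbabilityMeasure (lawGivenCount κ coordTime t n
      (randomMotion c coordTime coordMark t)) :=
    Measure.isProbabilityMeasure_map hm.aemeasurable
  have := Measure.isProbabilityMeasure_map (μ := σ) hscale.aemeasurable
  have hset (r : ℝ) : MeasurableSet {x : ℝ | |x| ≤ r} :=
    measurableSet_le (by fun_prop) measurable_const
  refine ext_of_integral_pow (R := c * t) ?_ ?_ fun k => ?_
  · rw [lawGivenCount, ae_map_iff hm.aemeasurable (hset _)]
    refine Measure.ae_smul_measure ?_ _
    filter_upwards [ae_restrict_of_ae (ae_eventCount_eq_iff hrate ht.le n),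
      ae_restrict_of_ae (ae_markedSeqLaw hρ), ae_restrict_mem hA] with p hp hp' hpA
    rw [randomMotion_of_eventCount_eq c _ hpA, smul_eq_mul, abs_mul, abs_of_pos hc]
    exact mul_le_mul_of_nonneg_left (abs_legSum_le hp'.1 hp'.2 (hp.mp hpA)) hc.le
  · rw [ae_map_iff hscale.aemeasurable (hset _)]
    filter_upwards [hσ] with x hx
    rw [abs_mul, abs_of_pos (mul_pos hc ht)]
    exact mul_le_of_le_one_right (mul_pos hc ht).le hx
  · rw [lawGivenCount, integral_map hm.aemeasurable (by fun_prop),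
      integral_map hscale.aemeasurable (by fun_prop), ProbabilityTheory.cond,
      integral_smul_measure, setIntegral_randomMotion_pow hrate ht.le, ENNReal.toReal_inv,
      ← Measure.real, hκA, smul_eq_mul, integral_legPow hrate hρ, integral_legPow hrate hρ,
      if_pos ht.le, if_pos ht.le, hmom k, hmom 0]
    simp only [mul_pow, integral_const_mul, pow_zero, integral_const, probReal_univ,
      Nat.choose_zero_right, Nat.cast_one, smul_eq_mul, mul_one]
    -- Since `C(n+k,k) k!/(n+k)! = 1/n!`, the ratio to the case `k = 0` is exactly `(ct)^k` times
    -- the `k`-th moment of `σ`.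
    have hch : ((n + k).choose k : ℝ) * k.factorial * n.factorial = (n + k).factorial := by
      have := Nat.add_choose_mul_factorial_mul_factorial n k
      rw [mul_right_comm]
      exact_mod_cast this
    have h1 : ((n + k).choose k : ℝ) ≠ 0 := by
      exact_mod_cast (Nat.choose_pos (Nat.le_add_left k n)).ne'
    have h2 : (k.factorial : ℝ) ≠ 0 := by positivity
    have h3 : (n.factorial : ℝ) ≠ 0 := by positivity
    rw [← hch]
    simp only [add_zero, Nat.factorial_zero, Nat.cast_one]
    field_simp
    ring

end Laws

theorem momentSeries_eq_mk_map (ν : ℝ) :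
    momentSeries ν = PowerSeries.mk fun i => ∫ y, y ^ i ∂(angleLaw ν).map Real.cos := by
  ext p
  rw [momentSeries, PowerSeries.coeff_mk, PowerSeries.coeff_mk,
    integral_map (by fun_prop) (by fun_prop)]

/-- The conditional law of `cosMotion` given `n` events, from the coefficients of the power of
the moment series. -/
theorem lawGivenCount_cosMotion {Ω : Type*} [MeasurableSpace Ω] {P : Measure Ω}
    [IsProbabilityMeasure P] {rate : ℝ} (hrate : 0 < rate) {ν v : ℝ} (hv : 0 ≤ v)
    [IsProbabilityMeasure (angleLaw v)] {T θ : ℕ → Ω → ℝ}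
    (h : IsMarkedPoissonClock P rate (angleLaw ν) T θ) {c t : ℝ} (hc : 0 < c) (ht : 0 < t)
    (n : ℕ) (hmom : ∀ k, PowerSeries.coeff k (momentSeries ν ^ (n + 1)) =
      (n + k).choose k * ∫ θ, Real.cos θ ^ k ∂angleLaw v) :
    lawGivenCount P T t n (cosMotion c T θ t) = conditionalDensityLaw v (c * t) := by
  have := isProbabilityMeasure_expMeasure hrate
  have hcos := h.comp Real.measurable_cos
  have := hcos.isProbabilityMeasure
  have := Measure.isProbabilityMeasure_map (μ := angleLaw v) Real.measurable_cos.aemeasurable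
  rw [← map_mul_cos_angleLaw hv (mul_pos hc ht)]
  refine (hcos.lawGivenCount_eq_map hrate (ae_abs_le_one_map_cos _) hc ht n
    (σ := (angleLaw v).map Real.cos) (ae_abs_le_one_map_cos _) fun k => ?_).trans ?_
  · rw [← momentSeries_eq_mk_map, hmom, integral_map (by fun_prop) (by fun_prop)]
  · rw [Measure.map_map (by fun_prop) (by fun_prop)]
    rfl

/-- `cosMotion` has the law of a coordinate of the random flight in dimension `2ν + 2`. -/
theorem cosMotion_law_eq_randomFlight_law {Ω Ω' : Type*} [MeasurableSpace Ω]
    [MeasurableSpace Ω'] {P : Measure Ω} [IsProbabilityMeasure P] {P' : Measure Ω'}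
    [IsProbabilityMeasure P'] {rate : ℝ} (hrate : 0 < rate) (c : ℝ) {ν : ℝ} (hν : 0 ≤ ν) (d : ℕ)
    (hd : (d : ℝ) = 2 * ν + 1) {T θ : ℕ → Ω → ℝ} {T' : ℕ → Ω' → ℝ}
    {V : ℕ → Ω' → Metric.sphere (0 : EuclideanSpace ℝ (Fin (d + 1))) 1}
    (h : IsMarkedPoissonClock P rate (angleLaw ν) T θ)
    (h' : IsMarkedPoissonClock P' rate (uniformDirection (d + 1)) T' V) :
    (∀ t : ℝ, 0 < t → ∀ n : ℕ, lawGivenCount P T t n (cosMotion c T θ t) =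
      lawGivenCount P' T' t n (fun ω => randomFlight c T' V t ω 0)) ∧
    IdentDistrib (fun ω (t : ℝ≥0) => cosMotion c T θ t ω)
      (fun ω (t : ℝ≥0) => randomFlight c T' V t ω 0) P P' := by
  have := isProbabilityMeasure_expMeasure hrate
  have := h.isProbabilityMeasure
  have hcos := h.comp Real.measurable_cos
  have := hcos.isProbabilityMeasure
  have hV := h'.comp (g := fun v : Metric.sphere (0 : EuclideanSpace ℝ (Fin (d + 1))) 1 =>
    (v : EuclideanSpace ℝ (Fin (d + 1))) 0) (by fun_prop)
  rw [map_coord_uniformDirection hν d hd] at hV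
  have e (t : ℝ) (ω : Ω') : randomFlight c T' V t ω 0 =
      randomMotion c T' (fun j ω => (V j ω : EuclideanSpace ℝ (Fin (d + 1))) 0) t ω := by
    simp [randomFlight, randomMotion]
  simp_rw [e]
  refine ⟨fun t _ n => (hcos.lawGivenCount_eq c t n).trans (hV.lawGivenCount_eq c t n).symm,
    ?_, ?_, (hcos.map_process c).trans (hV.map_process c).symm⟩
  · exact (measurable_pi_lambda _ fun t : ℝ≥0 => measurable_randomMotion hcos.clock.measurable
      hcos.measurable c t).aemeasurable
  · exact (measurable_pi_lambda _ fun t : ℝ≥0 => measurable_randomMotion hV.clock.measurable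
      hV.measurable c t).aemeasurable

end

/-! ### Assembly of the theorem. -/

theorem theorem3 {Ω Ω' : Type*} [MeasurableSpace Ω] [MeasurableSpace Ω']
    (P : Measure Ω) [IsProbabilityMeasure P] (P' : Measure Ω') [IsProbabilityMeasure P']
    (c rate : ℝ) (hc : 0 < c) (hrate : 0 < rate) :
    -- the law of `X_ν(t)` given `N(t) = 0`
    (∀ ν : ℝ, 0 ≤ ν → ∀ T θ : ℕ → Ω → ℝ, IsMarkedPoissonClock P rate (angleLaw ν) T θ →
      ∀ t : ℝ, 0 < t →
        lawGivenCount P T t 0 (cosMotion c T θ t) = conditionalDensityLaw ν (c * t)) ∧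
    -- the law of `X_0(t)` given `N(t) = n`
    (∀ T θ : ℕ → Ω → ℝ, IsMarkedPoissonClock P rate (angleLaw 0) T θ →
      ∀ t : ℝ, 0 < t → ∀ n : ℕ, 1 ≤ n →
        lawGivenCount P T t n (cosMotion c T θ t) =
          conditionalDensityLaw ((n : ℝ) / 2) (c * t)) ∧
    -- the law of `X_1(t)` given `N(t) = n`
    (∀ T θ : ℕ → Ω → ℝ, IsMarkedPoissonClock P rate (angleLaw 1) T θ →
      ∀ t : ℝ, 0 < t → ∀ n : ℕ, 1 ≤ n →
        lawGivenCount P T t n (cosMotion c T θ t) =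
          conditionalDensityLaw ((n : ℝ) + 1) (c * t)) ∧
    -- `X_0` and the projection of a planar random flight
    (∀ (T θ : ℕ → Ω → ℝ) (T' : ℕ → Ω' → ℝ)
      (V : ℕ → Ω' → Metric.sphere (0 : EuclideanSpace ℝ (Fin 2)) 1),
      IsMarkedPoissonClock P rate (angleLaw 0) T θ →
      IsMarkedPoissonClock P' rate (uniformDirection 2) T' V →
        (∀ t : ℝ, 0 < t → ∀ n : ℕ,
          lawGivenCount P T t n (cosMotion c T θ t) =
            lawGivenCount P' T' t n (fun ω => randomFlight c T' V t ω 0)) ∧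
        IdentDistrib (fun ω (t : ℝ≥0) => cosMotion c T θ t ω)
          (fun ω (t : ℝ≥0) => randomFlight c T' V t ω 0) P P') ∧
    -- `X_1` and the projection of a four-dimensional random flight
    (∀ (T θ : ℕ → Ω → ℝ) (T' : ℕ → Ω' → ℝ)
      (V : ℕ → Ω' → Metric.sphere (0 : EuclideanSpace ℝ (Fin 4)) 1),
      IsMarkedPoissonClock P rate (angleLaw 1) T θ →
      IsMarkedPoissonClock P' rate (uniformDirection 4) T' V →
        (∀ t : ℝ, 0 < t → ∀ n : ℕ,
          lawGivenCount P T t n (cosMotion c T θ t) =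
            lawGivenCount P' T' t n (fun ω => randomFlight c T' V t ω 0)) ∧
        IdentDistrib (fun ω (t : ℝ≥0) => cosMotion c T θ t ω)
          (fun ω (t : ℝ≥0) => randomFlight c T' V t ω 0) P P') := by
  refine ⟨fun ν hν T θ h t ht => ?_, fun T θ h t ht n _ => ?_, fun T θ h t ht n _ => ?_,
    fun T θ T' V h h' => ?_, fun T θ T' V h h' => ?_⟩
  · have := h.isProbabilityMeasure
    refine lawGivenCount_cosMotion hrate hν h hc ht 0 fun k => ?_
    rw [zero_add, pow_one, momentSeries, PowerSeries.coeff_mk, zero_add, Nat.choose_self,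
      Nat.cast_one, one_mul]
  · have := isProbabilityMeasure_angleLaw_natCast_div_two n
    exact lawGivenCount_cosMotion hrate (by positivity) h hc ht n
      (coeff_momentSeries_zero_pow n)
  · have : IsProbabilityMeasure (angleLaw ((n : ℝ) + 1)) := by
      simpa using isProbabilityMeasure_angleLaw_natCast (n + 1)
    exact lawGivenCount_cosMotion hrate (by positivity) h hc ht n
      (coeff_momentSeries_one_pow n)
  -- The parameter is the dimension minus one, `2ν + 1`: here `1` for the plane, and `3` below for
  -- dimension four.
  · exact cosMotion_law_eq_randomFlight_law hrate c le_rfl 1 (by norm_num) h h'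
  · exact cosMotion_law_eq_randomFlight_law hrate c zero_le_one 3 (by norm_num) h h'
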